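/- **Setting.** Let $g,h:\mathbb R^d\to\mathbb R$ be convex and $L$-smooth (differentiable with $L$-Lipschitz gradient, $L>0$), let $r:\mathbb R^d\to\mathbb R\cup\{\infty\}$ be proper and lower semicontinuous (possibly non-convex and non-smooth), and let $x_1\in\mathrm{dom}(r)$. For $\mu>0$ put $\mathrm{prox}_{\mu r}(x)=\arg\min_y\{\frac1{2\mu}\|y-x\|^2+r(y)\}$ (a set; below $\mathrm{prox}_{\mu r}(x)$ also denotes the value of one fixed measurable selection, the same in the algorithm and in the conclusion), $r_\mu(x)=\min_y\{\frac1{2\mu}\|y-x\|^2+r(y)\}$, $F_\mu=g-h+r_\mu=\bigl(g+\frac1{2\mu}\|\cdot\|^2\bigr)-(h+R_\mu)$ with $R_\mu$ convex and $\frac1\mu\mathrm{prox}_{\mu r}(x)\in\partial R_\mu(x)$. Let $\hat\partial r$ be the Fréchet subdifferential. We consider three conditions on $r$: (i) $r$ is real-valued and Lipschitz; (ii) $r$ is bounded below and finite-valued; (iii) $g-h+r_{\mu}$ is level bounded for some $\mu\in(0,1)$, and $r$ is bounded below and finite-valued on some nonempty compact set. Bounded initial gap means: there are $\Delta_1,\mu_0>0$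 with $F_\mu(x_1)-\inf F_\mu\le\Delta_1$ for all $\mu\in(0,\mu_0]$. **Stagewise algorithm.** Fix a constant $\gamma>0$. In stage $k=1,\dots,K$, a stochastic subroutine, started at $x_k$, is run on $F_k(x)=g(x)+\frac1{2\mu}\|x\|^2-\langle\nabla h(x_k)+\frac1\mu\mathrm{prox}_{\mu r}(x_k),x-x_k\rangle+\frac\gamma2\|x-x_k\|^2$ (up to a constant) and its output is $x_{k+1}$. The final output is $x_\tau$, where $\tau\in\{1,\dots,K\}$ is independent of the samples with $\Pr(\tau=k)=k^\alpha/\sum_{j=1}^Kj^\alpha$, $\alpha\ge1$. Put $w_\tau=\mathrm{prox}_{\mu r}(x_\tau)$. *SPG.* Independent samples $\xi\sim\nu_\xi$ and $\varsigma\sim\nu_\varsigma$ give unbiased stochastic gradients $\nabla g(x;\xi)$, $\nabla h(x;\varsigma)$ of $g,h$ such that $\nabla g(x;\xi)-\nabla h(x;\varsigma)$ has variance at most $G^2$ for every $x$. With $y_1=x_k$, $\eta_t=3/(\gamma(t+1))$ and fresh samples, for $t=1,\dots,T_k$, $$y_{t+1}=\arg\min_x\ \langle x,\nabla g(y_t;\xi_t)-\nabla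 h(x_k;\varsigma_t)-\tfrac1\mu\mathrm{prox}_{\mu r}(x_k)\rangle+\tfrac1{2\mu}\|x\|^2+\tfrac\gamma2\|x-x_k\|^2+\tfrac1{2\eta_t}\|x-y_t\|^2,$$ and $x_{k+1}=\sum_{t=2}^{T_k+1}t\,y_t/\sum_{t=2}^{T_k+1}t$. *SVRG.* Here $g=\frac1n\sum_{i=1}^ng_i$ with each $g_i$ $L$-smooth. Let $\eta=0.05/L$, $S_k=\lceil\log_2k\rceil$, $T_k\ge\max(2,200L/\gamma)$, $\bar x^{(0)}=x_k$. For $s=1,\dots,S_k$: $y_0=\bar x^{(s-1)}$; for $t=1,\dots,T_k$ draw $i_t$ uniformly from $\{1,\dots,n\}$, set $v_t=\nabla g_{i_t}(y_{t-1})-\nabla g_{i_t}(\bar x^{(s-1)})+\nabla g(\bar x^{(s-1)})-\nabla h(x_k)-\frac1\mu\mathrm{prox}_{\mu r}(x_k)$ and $y_t=\arg\min_x\langle v_t,x-y_{t-1}\rangle+\frac1{2\eta}\|x-y_{t-1}\|^2+\frac1{2\mu}\|x\|^2+\frac\gamma2\|x-x_k\|^2$; $\bar x^{(s)}=\frac1{T_k}\sum_{t=1}^{T_k}y_t$.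 Then $x_{k+1}=\bar x^{(S_k)}$. All draws are independent. **Theorem.** In each of the following cases there are constants $C,\varepsilon_0>0$, independent of $\varepsilon$ and $K$, such that for all $\varepsilon\in(0,\varepsilon_0]$ $$\mathrm E\|x_\tau-w_\tau\|\le C\varepsilon,\qquad \mathrm E\bigl[\mathrm{dist}\bigl(\nabla h(w_\tau),\nabla g(w_\tau)+\hat\partial r(w_\tau)\bigr)\bigr]\le C\varepsilon .$$ (a) SPG, $\gamma\ge3L$, under (i) with bounded initial gap, with $\mu=\varepsilon$ and any number $K\ge\varepsilon^{-4}$ of stages (in particular $K=\lceil\varepsilon^{-4}\rceil=O(1/\varepsilon^4)$); (b) SPG, $\gamma\ge3L$, under (ii) with bounded initial gap, with $\mu=\varepsilon^2$ and any $K\ge\varepsilon^{-6}$ (in particular $K=O(1/\varepsilon^6)$); in (a) and (b), the integers $T_k$ are fixed (not depending on $\varepsilon,K$) with $T_k\ge 3Lk/\gamma+3$ for $k\ge1$, and either $\sum_k1/T_k<\infty$, or $\mathrm E[F_\mu(x_k)]-\inf F_\mu\le\Delta$ for $k=1,\dots,K$, with $\Delta$ not depending on $\varepsilon$ and $K$;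 (c) SVRG, $\gamma>0$, with $\mu=\varepsilon$ and any $K\ge\varepsilon^{-4}$ under (i) with bounded initial gap; or with $\mu=\varepsilon^2$ and any $K\ge\varepsilon^{-6}$ under (ii) with bounded initial gap, or under (iii). -/

import Mathlib

open MeasureTheory ProbabilityTheory Set
open scoped ENNReal

noncomputable section

namespace SSDC

/-- The space `ℝ^d` with its Euclidean norm. -/
abbrev Vec (d : ℕ) : Type := EuclideanSpace ℝ (Fin d)

variable {d : ℕ}

/-! ### Smoothness, proximal mapping, Moreau envelope, Fréchet subdifferential -/

/-- `f` is `L`-smooth: differentiable with an `L`-Lipschitz gradient. -/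
def LSmooth (L : ℝ) (f : Vec d → ℝ) : Prop :=
  Differentiable ℝ f ∧ ∀ x y, ‖gradient f x - gradient f y‖ ≤ L * ‖x - y‖

/-- A proper lower semicontinuous function with values in `ℝ ∪ {∞}`. -/
def ProperLsc (r : Vec d → EReal) : Prop :=
  (∃ x, r x ≠ ⊤) ∧ (∀ x, r x ≠ ⊥) ∧ LowerSemicontinuous r

/-- The objective `y ↦ ‖y - x‖² / (2μ) + r y` of the proximal problem at `x`. -/
def proxObj (μ : ℝ) (r : Vec d → EReal) (x y : Vec d) : EReal :=
  ((‖y - x‖ ^ 2 / (2 * μ) : ℝ) : EReal) + r y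

/-- The (set-valued) proximal mapping: all minimizers of the proximal problem at `x`. -/
def prox (μ : ℝ) (r : Vec d → EReal) (x : Vec d) : Set (Vec d) :=
  {v | ∀ y, proxObj μ r x v ≤ proxObj μ r x y}

/-- The Moreau envelope `r_μ`. -/
def moreau (μ : ℝ) (r : Vec d → EReal) (x : Vec d) : EReal :=
  ⨅ y, proxObj μ r x y

/-- The smoothed objective `F_μ = g - h + r_μ`. The envelope is finite, so that `toReal` loses
nothing, whenever `r` is proper and is bounded below or Lipschitz. -/
def envObj (g h : Vec d → ℝ) (r : Vec d → EReal) (μ : ℝ) (x : Vec d) : ℝ :=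
  g x - h x + (moreau μ r x).toReal

/-- The Fréchet subdifferential of `r` at a point `w` of its domain: the condition
`liminf_{x → w} (r x - r w - ⟪v, x - w⟫) / ‖x - w‖ ≥ 0`, cleared of denominators. -/
def frechetSubdiff (r : Vec d → EReal) (w : Vec d) : Set (Vec d) :=
  {v | r w ≠ ⊤ ∧ r w ≠ ⊥ ∧ ∀ δ : ℝ, 0 < δ → ∀ᶠ x in nhds w,
    r w + ((inner ℝ v (x - w) - δ * ‖x - w‖ : ℝ) : EReal) ≤ r x}

/-- `dist(∇h(w), ∇g(w) + ∂̂r(w))`; it is `∞` where the Fréchet subdifferential is empty. -/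
def critDist (g h : Vec d → ℝ) (r : Vec d → EReal) (w : Vec d) : ℝ≥0∞ :=
  Metric.infEDist (gradient h w) ((fun v => gradient g w + v) '' frechetSubdiff r w)

/-! ### Assumptions -/

/-- `r` is (real-valued and) Lipschitz continuous. -/
def RegLipschitz (r : Vec d → EReal) : Prop :=
  ∃ ρ : Vec d → ℝ, (∀ x, r x = (ρ x : EReal)) ∧ ∃ G : NNReal, LipschitzWith G ρ

/-- `r` is bounded below by a real number. -/
def LowerBounded (r : Vec d → EReal) : Prop :=
  ∃ m : ℝ, ∀ x, (m : EReal) ≤ r x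

/-- `r` is bounded below and finite-valued. -/
def RegFinite (r : Vec d → EReal) : Prop :=
  LowerBounded r ∧ ∀ x, r x ≠ ⊤

/-- `g - h + r_μ` is level bounded for some `μ < 1`, and `r` is bounded below and finite-valued
on some compact set. -/
def RegLevelBounded (g h : Vec d → ℝ) (r : Vec d → EReal) : Prop :=
  (∃ μ ∈ Ioo (0 : ℝ) 1, ∀ c : ℝ, Bornology.IsBounded {x | envObj g h r μ x ≤ c}) ∧
  (∃ S : Set (Vec d), IsCompact S ∧ S.Nonempty ∧ ∀ x ∈ S, r x ≠ ⊤) ∧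
  LowerBounded r

/-- The initial optimality gap of the smoothed problems at `x₁` is bounded by a constant that does
not depend on `μ`. -/
def InitialGap (g h : Vec d → ℝ) (r : Vec d → EReal) (x₁ : Vec d) : Prop :=
  ∃ Δ μ₀ : ℝ, 0 < μ₀ ∧ ∀ μ ∈ Ioc 0 μ₀, ∀ y, envObj g h r μ x₁ - envObj g h r μ y ≤ Δ

/-- `v(x; ξ)`, with `ξ` distributed as `ν`, is an unbiased stochastic gradient of `f`. -/
def UnbiasedGradient {Ξ : Type*} [MeasurableSpace Ξ] (ν : Measure Ξ)
    (v : Vec d → Ξ → Vec d) (f : Vec d → ℝ) : Prop :=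
  Measurable (Function.uncurry v) ∧
  ∀ x, Integrable (v x) ν ∧ ∫ ξ, v x ξ ∂ν = gradient f x

/-- The variance of `vg(x; ξ) - vh(x; ς)`, for independent `ξ ∼ νξ` and `ς ∼ νς`, is at most `G²`
at every point `x`. -/
def VarianceBound {Ξ Z : Type*} [MeasurableSpace Ξ] [MeasurableSpace Z]
    (νξ : Measure Ξ) (νς : Measure Z) (vg : Vec d → Ξ → Vec d) (vh : Vec d → Z → Vec d)
    (G : ℝ) : Prop :=
  ∀ x, ∫⁻ q, ‖(vg x q.1 - vh x q.2) - ∫ q', (vg x q'.1 - vh x q'.2) ∂(νξ.prod νς)‖ₑ ^ 2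
    ∂(νξ.prod νς) ≤ ENNReal.ofReal (G ^ 2)

/-! ### The algorithms -/

/-- The convex component `x ↦ ‖x‖² / (2μ)` in the DC decomposition of the Moreau envelope. -/
def quadReg (μ : ℝ) (x : Vec d) : ℝ := ‖x‖ ^ 2 / (2 * μ)

/-- One call of the stochastic proximal gradient method (with the proximal step over the whole
space) with `T` iterations, started at `c`, for the strongly convex majorant
`g + q - ⟪∂H(c), · - c⟫ + (γ/2) ‖· - c‖²`. Here `vg` and `vH` are the stochastic gradients of `g`
and `H`, `s t` is the sample of iteration `t`, the step size is `η_t = 3 / (γ (t + 1))`, and `out`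
is the output, the average of `y 2, …, y (T+1)` with weights `2, …, T+1`. -/
def SPGCall {Ξ Z : Type*} (vg : Vec d → Ξ → Vec d) (vH : Vec d → Z → Vec d)
    (q : Vec d → ℝ) (γ : ℝ) (T : ℕ) (c : Vec d) (s : ℕ → Ξ × Z) (out : Vec d) : Prop :=
  ∃ y : ℕ → Vec d, y 1 = c ∧
    (∀ t ∈ Finset.Icc 1 T,
      IsMinOn (fun x => inner ℝ x (vg (y t) (s t).1 - vH c (s t).2) + q x + γ / 2 * ‖x - c‖ ^ 2
        + 1 / (2 * (3 / (γ * (t + 1)))) * ‖x - y t‖ ^ 2) univ (y (t + 1))) ∧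
    out = (∑ t ∈ Finset.Icc 2 (T + 1), (t : ℝ))⁻¹ • ∑ t ∈ Finset.Icc 2 (T + 1), (t : ℝ) • y t

/-- One call of proximal SVRG with `S` epochs of `T` iterations and step size `η`, started at `c`,
for the strongly convex majorant `g + q - ⟪uH c, · - c⟫ + (γ/2) ‖· - c‖²`, where `g` is the
average of the `gi` and `uH c` is a subgradient of `H` at `c`; `i s t` is the component drawn in
iteration `t` of epoch `s`. -/
def SVRGCall {n : ℕ} (gi : Fin n → Vec d → ℝ) (g : Vec d → ℝ) (uH : Vec d → Vec d)
    (q : Vec d → ℝ) (γ η : ℝ) (T S : ℕ) (c : Vec d) (i : ℕ → ℕ → Fin n) (out : Vec d) : Prop :=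
  ∃ (xbar : ℕ → Vec d) (y : ℕ → ℕ → Vec d), xbar 0 = c ∧
    (∀ s < S, y (s + 1) 0 = xbar s ∧
      (∀ t < T,
        IsMinOn (fun x =>
          inner ℝ (gradient (gi (i (s + 1) (t + 1))) (y (s + 1) t)
              - gradient (gi (i (s + 1) (t + 1))) (xbar s)
              + (gradient g (xbar s) - uH c)) (x - y (s + 1) t)
            + 1 / (2 * η) * ‖x - y (s + 1) t‖ ^ 2 + q x + γ / 2 * ‖x - c‖ ^ 2)
          univ (y (s + 1) (t + 1))) ∧
      xbar (s + 1) = (T : ℝ)⁻¹ • ∑ t ∈ Finset.Icc 1 T, y (s + 1) t) ∧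
    out = xbar S

/-- The stagewise algorithm with `K` stages: `x 1 = x₁`, and `x (k + 1)` is the output of the
stochastic subroutine called in stage `k` at `x k` with the random samples `s k`. -/
def StagewiseRun {Ω 𝒮 : Type*} (x₁ : Vec d) (K : ℕ) (call : ℕ → Vec d → 𝒮 → Vec d → Prop)
    (s : ℕ → Ω → 𝒮) (x : ℕ → Ω → Vec d) : Prop :=
  (∀ ω, x 1 ω = x₁) ∧ ∀ k ∈ Finset.Icc 1 K, ∀ ω, call k (x k ω) (s k ω) (x (k + 1) ω)

/-- The random index `τ ∈ {1, …, K}` has `ℙ(τ = k) = k^α / ∑_{j=1}^K j^α`. -/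
def PowerSampled {Ω : Type*} [MeasurableSpace Ω] (P : Measure Ω) (α : ℝ) (K : ℕ)
    (τ : Ω → ℕ) : Prop :=
  Measurable τ ∧ ∀ k ∈ Finset.Icc 1 K,
    P {ω | τ ω = k} = ENNReal.ofReal ((k : ℝ) ^ α / ∑ j ∈ Finset.Icc 1 K, (j : ℝ) ^ α)

/-- A run with `K` stages of the stagewise algorithm with SPG as subroutine (`T k` iterations in
stage `k`) on `min g + ‖·‖²/(2μ) - (h + R_μ)`. The subgradient of `R_μ` at `x` is `p x / μ`, where
`p x ∈ prox_{μ r}(x)`. The samples are i.i.d. over all stages and iterations, and the output index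
`τ` is independent of them. -/
structure SPGRun {Ω Ξ Z : Type*} [MeasurableSpace Ω] [MeasurableSpace Ξ] [MeasurableSpace Z]
    (P : Measure Ω) (νξ : Measure Ξ) (νς : Measure Z)
    (vg : Vec d → Ξ → Vec d) (vh : Vec d → Z → Vec d) (r : Vec d → EReal) (x₁ : Vec d)
    (μ γ α : ℝ) (T : ℕ → ℕ) (K : ℕ) (p : Vec d → Vec d)
    (s : ℕ → ℕ → Ω → Ξ × Z) (x : ℕ → Ω → Vec d) (τ : Ω → ℕ) : Prop where
  prox_measurable : Measurable p
  prox_mem : ∀ x, p x ∈ prox μ r x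
  sample_measurable : ∀ k t, Measurable (s k t)
  sample_law : ∀ k t, P.map (s k t) = νξ.prod νς
  sample_indep : iIndepFun (fun (j : ℕ × ℕ) => s j.1 j.2) P
  index_law : PowerSampled P α K τ
  index_indep : IndepFun τ (fun ω (j : ℕ × ℕ) => s j.1 j.2 ω) P
  run : StagewiseRun x₁ K
    (fun k => SPGCall vg (fun x ς => vh x ς + μ⁻¹ • p x) (quadReg μ) γ (T k))
    (fun k ω t => s k t ω) x

/-- A run with `K` stages of the stagewise algorithm with SVRG as subroutine, with step size
`0.05 / L` and, in stage `k`, `⌈log₂ k⌉` epochs of `T k` iterations, on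
`min g + ‖·‖²/(2μ) - (h + R_μ)`. The components are drawn independently and uniformly. -/
structure SVRGRun {Ω : Type*} [MeasurableSpace Ω] {n : ℕ} (P : Measure Ω)
    (gi : Fin n → Vec d → ℝ) (g h : Vec d → ℝ) (r : Vec d → EReal) (x₁ : Vec d)
    (L μ γ α : ℝ) (T : ℕ → ℕ) (K : ℕ) (p : Vec d → Vec d)
    (i : ℕ → ℕ → ℕ → Ω → Fin n) (x : ℕ → Ω → Vec d) (τ : Ω → ℕ) : Prop where
  prox_measurable : Measurable p
  prox_mem : ∀ x, p x ∈ prox μ r x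
  sample_measurable : ∀ k s t, Measurable (i k s t)
  sample_law : ∀ k s t j, P {ω | i k s t ω = j} = (n : ℝ≥0∞)⁻¹
  sample_indep : iIndepFun (fun (j : ℕ × ℕ × ℕ) => i j.1 j.2.1 j.2.2) P
  index_law : PowerSampled P α K τ
  index_indep : IndepFun τ (fun ω (j : ℕ × ℕ × ℕ) => i j.1 j.2.1 j.2.2 ω) P
  run : StagewiseRun x₁ K
    (fun k => SVRGCall gi g (fun x => gradient h x + μ⁻¹ • p x) (quadReg μ) γ (0.05 / L) (T k)
      ⌈Real.logb 2 k⌉₊)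
    (fun k ω s t => i k s t ω) x

/-! ### The guarantees -/

/-- `𝔼[f] ≤ b`, in the sense of the upper expectation (no measurability of `f` is presupposed). -/
def ExpectLE {Ω : Type*} [MeasurableSpace Ω] (P : Measure Ω) (f : Ω → ℝ≥0∞) (b : ℝ) : Prop :=
  ∃ D : Ω → ℝ≥0∞, Measurable D ∧ (∀ ω, f ω ≤ D ω) ∧ ∫⁻ ω, D ω ∂P ≤ ENNReal.ofReal b

/-- With `x_τ = x (τ ω) ω` and `w_τ = p x_τ ∈ prox_{μ r}(x_τ)`: `𝔼‖x_τ - w_τ‖ ≤ b` and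
`𝔼[dist(∇h(w_τ), ∇g(w_τ) + ∂̂r(w_τ))] ≤ b`. -/
def NearlyCritical {Ω : Type*} [MeasurableSpace Ω] (P : Measure Ω) (g h : Vec d → ℝ)
    (r : Vec d → EReal) (p : Vec d → Vec d) (x : ℕ → Ω → Vec d) (τ : Ω → ℕ) (b : ℝ) : Prop :=
  ExpectLE P (fun ω => ‖x (τ ω) ω - p (x (τ ω) ω)‖ₑ) b ∧
  ExpectLE P (fun ω => critDist g h r (p (x (τ ω) ω))) b

end SSDC

end

open SSDC

/-! Let `z` be the exact minimizer of the majorant of the stage with center `c`. A point of `prox μ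
r c` competes in the proximal problem at every other point; with the convexity of `h`, this shows
that `F_μ` grows from `c` by no more than the majorant does (`envObj_sub_le`). The majorant is
strongly convex, so a stage lowers `F_μ` by at least `γ/2 * ‖c - z‖²`, up to the optimization error
of the subroutine (`SmoothedDC.envGap_descent`). Since `F_μ` is bounded below, summation with the
weights `k ^ α` gives an average of `𝔼‖x k - z k‖²` of order `1/K`.

The distance to `z` measures criticality. Stationarity of `z` and the Fréchet subgradient `(x -
w)/μ` at `w ∈ prox μ r x` give a residual of at most `2L‖x - w‖ + (L + γ + 1/μ)‖x - z‖`
(`critDist_le`). With `μ = ε ^ a` the second term is of order `ε` once `‖x - z‖` is of order `ε ^ (a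
+ 1)`, hence `K ≥ ε ^ (-2(a + 1))`. The first term is `O(μ)` for Lipschitz `r`, where `a = 1`, and
otherwise `O(√μ)` by a comparison of two envelopes, where `a = 2`.

The subroutines enter only through their optimization error. For SPG the noise is centered given the
past, and averaging with weights proportional to `t` leaves an expected error `O(1/T k)` plus a part
absorbed by the descent (`SmoothedDC.spg_stage`); linear growth of `T k` makes the weighted sum of
these errors `O(K ^ α)`. For SVRG no variance estimate is needed: for small `μ` the quadratic term
dominates `L`, and each epoch contracts the distance to `z` for every draw of the components
(`SVRGCall.norm_sub_le`). -/

namespace SSDC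

/-! ### Convex and smooth functions, and the resolvent of the gradient. -/

section Smooth

variable {d : ℕ} {f g h : Vec d → ℝ} {L M : ℝ}

lemma hasDerivAt_line (hf : Differentiable ℝ f) (x v : Vec d) (t : ℝ) :
    HasDerivAt (fun t : ℝ => f (x + t • v)) (inner ℝ (gradient f (x + t • v)) v) t := by
  have h1 : HasDerivAt (fun t : ℝ => x + t • v) v t := by
    simpa using ((hasDerivAt_id t).smul_const v).const_add x
  have h2 := ((hf (x + t • v)).hasGradientAt.hasFDerivAt).comp_hasDerivAt t h1
  rwa [InnerProductSpace.toDual_apply_apply] at h2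

lemma gradient_le_of_convexOn (hc : ConvexOn ℝ univ f) (hf : Differentiable ℝ f) (x y : Vec d) :
    f x + inner ℝ (gradient f x) (y - x) ≤ f y := by
  have hconv : ConvexOn ℝ univ (fun t : ℝ => f (x + t • (y - x))) := by
    refine ⟨convex_univ, fun s _ t _ a b ha hb hab => ?_⟩
    have := hc.2 (mem_univ (x + s • (y - x))) (mem_univ (x + t • (y - x))) ha hb hab
    convert this using 2
    have : a • x + b • x = x := by rw [← add_smul, hab, one_smul]
    simp only [smul_add, smul_smul, add_smul, smul_eq_mul]
    nth_rewrite 1 [← this]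
    abel
  have h0 := hasDerivAt_line hf x (y - x) 0
  have := hconv.le_slope_of_hasDerivAt (mem_univ (0 : ℝ)) (mem_univ (1 : ℝ)) one_pos h0
  rw [slope_def_field] at this
  simp only [zero_smul, one_smul, add_zero, sub_zero, div_one, add_sub_cancel] at this
  linarith

lemma inner_gradient_sub_nonneg (hc : ConvexOn ℝ univ f) (hf : Differentiable ℝ f)
    (x y : Vec d) : 0 ≤ inner ℝ (gradient f x - gradient f y) (x - y) := by
  have h1 := gradient_le_of_convexOn hc hf x y
  have h2 := gradient_le_of_convexOn hc hf y x
  rw [← neg_sub x y, inner_neg_right] at h1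
  rw [inner_sub_left]
  linarith

/-- Along the segment from `x` to `y`, the difference between `f` and the claimed bound has
nonpositive derivative, by the Lipschitz estimate for the gradient and Cauchy–Schwarz. -/
lemma LSmooth.le_quadratic (hf : LSmooth L f) (x y : Vec d) :
    f y ≤ f x + inner ℝ (gradient f x) (y - x) + L / 2 * ‖y - x‖ ^ 2 := by
  set v := y - x with hv
  have hd : ∀ t : ℝ, HasDerivAt
      (fun t : ℝ => f (x + t • v) - t * inner ℝ (gradient f x) v - L / 2 * t ^ 2 * ‖v‖ ^ 2)
      (inner ℝ (gradient f (x + t • v)) v - inner ℝ (gradient f x) v - L * t * ‖v‖ ^ 2) t := by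
    intro t
    have h1 := ((hasDerivAt_line hf.1 x v t).sub
      ((hasDerivAt_id t).mul_const (inner ℝ (gradient f x) v))).sub
      (((hasDerivAt_pow 2 t).const_mul (L / 2)).mul_const (‖v‖ ^ 2))
    refine h1.congr_deriv ?_
    rw [one_mul, show (2 - 1) = 1 from rfl, pow_one]
    push_cast
    ring
  have hanti : AntitoneOn
      (fun t : ℝ => f (x + t • v) - t * inner ℝ (gradient f x) v - L / 2 * t ^ 2 * ‖v‖ ^ 2)
      (Icc 0 1) := by
    refine antitoneOn_of_deriv_nonpos (convex_Icc 0 1)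
      (fun t _ => (hd t).continuousAt.continuousWithinAt)
      (fun t _ => (hd t).differentiableAt.differentiableWithinAt) fun t ht => ?_
    rw [interior_Icc] at ht
    rw [(hd t).deriv, ← inner_sub_left]
    have h1 := real_inner_le_norm (gradient f (x + t • v) - gradient f x) v
    have h2 := hf.2 (x + t • v) x
    rw [add_sub_cancel_left, norm_smul, Real.norm_eq_abs, abs_of_pos ht.1] at h2
    nlinarith [mul_le_mul_of_nonneg_right h2 (norm_nonneg v)]
  have := hanti (left_mem_Icc.2 zero_le_one) (right_mem_Icc.2 zero_le_one) zero_le_one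
  simp only [zero_smul, one_smul, add_zero, zero_mul, one_mul, sub_zero, hv, add_sub_cancel,
    ne_eq, OfNat.ofNat_ne_zero, not_false_eq_true, zero_pow, mul_zero, one_pow, mul_one] at this
  simp only [hv]
  linarith

lemma LSmooth.continuous_gradient (hf : LSmooth L f) : Continuous (gradient f) := by
  have : LipschitzWith (Real.toNNReal L) (gradient f) := by
    refine LipschitzWith.of_dist_le_mul fun x y => ?_
    rw [dist_eq_norm, dist_eq_norm]
    exact (hf.2 x y).trans (mul_le_mul_of_nonneg_right (Real.le_coe_toNNReal L) (norm_nonneg _))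
  exact this.continuous

/-- For a convex `g`, `L`-smooth with `L < M`, the operator `∇g + M` has a continuous inverse. -/
lemma exists_resolvent (hc : ConvexOn ℝ univ g) (hg : LSmooth L g) (hL : 0 < L) (hM : L < M) :
    ∃ J : Vec d → Vec d, Continuous J ∧ ∀ w, gradient g (J w) + M • J w = w := by
  have hM0 : 0 < M := hL.trans hM
  have hex : ∀ w : Vec d, ∃ z, gradient g z + M • z = w := by
    intro w
    let K : NNReal := ⟨L / M, by positivity⟩
    -- The equation for `z` is a fixed point equation for this map, a contraction because `L / M <
    -- 1`.
    have hK : ContractingWith K (fun z : Vec d => M⁻¹ • (w - gradient g z)) := by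
      refine ⟨?_, LipschitzWith.of_dist_le_mul fun x y => ?_⟩
      · rw [← NNReal.coe_lt_coe]
        exact (div_lt_one hM0).2 hM
      · rw [dist_eq_norm, dist_eq_norm, ← smul_sub, sub_sub_sub_cancel_left, norm_smul,
          norm_inv, Real.norm_eq_abs, abs_of_pos hM0, norm_sub_rev]
        have := hg.2 x y
        change _ ≤ L / M * ‖x - y‖
        calc M⁻¹ * ‖gradient g x - gradient g y‖ ≤ M⁻¹ * (L * ‖x - y‖) := by gcongr
          _ = _ := by ring
    refine ⟨ContractingWith.fixedPoint _ hK, ?_⟩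
    have := hK.fixedPoint_isFixedPt
    set z := ContractingWith.fixedPoint _ hK
    have h2 : M⁻¹ • (w - gradient g z) = z := this
    rw [← h2, smul_smul, mul_inv_cancel₀ hM0.ne', one_smul, h2]
    abel
  choose J hJ using hex
  refine ⟨J, ?_, hJ⟩
  -- Monotonicity of `∇g` makes `∇g + M` strongly monotone with modulus `M`. Continuity of `J` is
  -- what later makes the stage minimizer a measurable function of the center.
  have : LipschitzWith (Real.toNNReal M⁻¹) J := by
    refine LipschitzWith.of_dist_le_mul fun x y => ?_
    rw [dist_eq_norm, dist_eq_norm, Real.coe_toNNReal _ (by positivity)]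
    have h1 := inner_gradient_sub_nonneg hc hg.1 (J x) (J y)
    have h2 : gradient g (J x) - gradient g (J y) = (x - y) - M • (J x - J y) := by
      rw [eq_sub_of_add_eq (hJ x), eq_sub_of_add_eq (hJ y), smul_sub]
      abel
    rw [h2, inner_sub_left, inner_smul_left, real_inner_self_eq_norm_sq] at h1
    have h3 := real_inner_le_norm (x - y) (J x - J y)
    simp only [conj_trivial] at h1
    rcases (norm_nonneg (J x - J y)).eq_or_lt with h0 | h0
    · rw [← h0]; positivity
    · rw [inv_mul_eq_div, le_div_iff₀ hM0]
      nlinarith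
  exact this.continuous

end Smooth

/-! ### The majorant of a stage. -/

section Quadratic

variable {d : ℕ}

/-- The minimizer of a positive definite multiple of `‖·‖²` plus a linear functional. -/
lemma eq_inv_smul_of_isMinOn {f : Vec d → ℝ} {a k : ℝ} {w y : Vec d} (ha : 0 < a)
    (hf : ∀ x, f x = a / 2 * ‖x‖ ^ 2 - inner ℝ w x + k) (hy : IsMinOn f univ y) :
    y = a⁻¹ • w := by
  have h1 : f y ≤ f (a⁻¹ • w) := hy (mem_univ _)
  rw [hf, hf] at h1
  -- Completing the square, `f y - f (a⁻¹ • w) = ‖a • y - w‖ ^ 2 / (2 * a)`.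
  have h2 : ‖a • y - w‖ ^ 2 ≤ 0 := by
    rw [norm_sub_sq_real, norm_smul, inner_smul_left, Real.norm_eq_abs, abs_of_pos ha]
    rw [norm_smul, inner_smul_right, real_inner_self_eq_norm_sq, norm_inv, Real.norm_eq_abs,
      abs_of_pos ha] at h1
    rw [real_inner_comm] at h1
    simp only [conj_trivial]
    field_simp at h1
    nlinarith
  have h3 : a • y - w = 0 := by
    have := pow_eq_zero_iff (two_ne_zero) |>.1 (le_antisymm h2 (sq_nonneg _))
    exact norm_eq_zero.1 this
  rw [← sub_eq_zero.1 h3, smul_smul, inv_mul_cancel₀ ha.ne', one_smul]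

/-- The strongly convex majorant of a stage with center `c`. -/
noncomputable def stageObj (g : Vec d → ℝ) (μ γ : ℝ) (u c x : Vec d) : ℝ :=
  g x + quadReg μ x - inner ℝ u x + γ / 2 * ‖x - c‖ ^ 2

variable {g : Vec d → ℝ} {L μ γ : ℝ} {u c z : Vec d}

/-- The exact second-order expansion at `z` of the quadratic part of the majorant. If `z` is
stationary, the linear coefficient is `-∇g z`; bounds on `g` around its tangent at `z` then become
bounds on the majorant around its minimum. -/
lemma quad_expand (x z : Vec d) :
    quadReg μ x - inner ℝ u x + γ / 2 * ‖x - c‖ ^ 2 =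
      quadReg μ z - inner ℝ u z + γ / 2 * ‖z - c‖ ^ 2 +
      inner ℝ ((μ⁻¹ + γ) • z - (u + γ • c)) (x - z) + (μ⁻¹ + γ) / 2 * ‖x - z‖ ^ 2 := by
  simp only [quadReg, norm_sub_sq_real, inner_sub_left, inner_sub_right, inner_add_left,
    inner_smul_left, real_inner_self_eq_norm_sq, conj_trivial]
  rw [real_inner_comm x z, real_inner_comm x c, real_inner_comm z c]
  rw [div_eq_mul_inv, mul_inv, div_eq_mul_inv (‖z‖ ^ 2), mul_inv]
  ring

lemma stageObj_lower (hc : ConvexOn ℝ univ g) (hg : LSmooth L g)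
    (hz : gradient g z + (μ⁻¹ + γ) • z = u + γ • c) (x : Vec d) :
    stageObj g μ γ u c z + (μ⁻¹ + γ) / 2 * ‖x - z‖ ^ 2 ≤ stageObj g μ γ u c x := by
  have h1 := gradient_le_of_convexOn hc hg.1 z x
  have h2 := quad_expand (μ := μ) (γ := γ) (u := u) (c := c) x z
  have h3 : (μ⁻¹ + γ) • z - (u + γ • c) = - gradient g z := by rw [← hz]; abel
  rw [h3, inner_neg_left] at h2
  simp only [stageObj]
  linarith

lemma stageObj_upper (hg : LSmooth L g)
    (hz : gradient g z + (μ⁻¹ + γ) • z = u + γ • c) (x : Vec d) :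
    stageObj g μ γ u c x ≤ stageObj g μ γ u c z + (L + (μ⁻¹ + γ)) / 2 * ‖x - z‖ ^ 2 := by
  have h1 := hg.le_quadratic z x
  have h2 := quad_expand (μ := μ) (γ := γ) (u := u) (c := c) x z
  have h3 : (μ⁻¹ + γ) • z - (u + γ • c) = - gradient g z := by rw [← hz]; abel
  rw [h3, inner_neg_left] at h2
  simp only [stageObj]
  linarith

end Quadratic

/-! ### Proximal points, the DC majorization, criticality, and bounds on the initial gap. -/

section Prox

variable {d : ℕ} {g h : Vec d → ℝ} {r : Vec d → EReal} {L μ γ : ℝ} {x y v c z : Vec d}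

lemma ProperLsc.ne_bot (hr : ProperLsc r) (x : Vec d) : r x ≠ ⊥ := hr.2.1 x

lemma proxObj_eq_coe (hr : ProperLsc r) (hy : r y ≠ ⊤) :
    proxObj μ r x y = ((‖y - x‖ ^ 2 / (2 * μ) + (r y).toReal : ℝ) : EReal) := by
  rw [proxObj, EReal.coe_add, EReal.coe_toReal hy (hr.ne_bot y)]

lemma ne_top_of_mem_prox (hr : ProperLsc r) (hv : v ∈ prox μ r x) : r v ≠ ⊤ := by
  obtain ⟨y, hy⟩ := hr.1
  intro htop
  have h1 := hv y
  rw [proxObj_eq_coe hr hy, proxObj, htop, EReal.coe_add_top, top_le_iff] at h1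
  exact EReal.coe_ne_top _ h1

lemma moreau_eq_of_mem_prox (hv : v ∈ prox μ r x) : moreau μ r x = proxObj μ r x v :=
  le_antisymm (iInf_le _ v) (le_iInf hv)

lemma moreau_toReal_of_mem_prox (hr : ProperLsc r) (hv : v ∈ prox μ r x) :
    (moreau μ r x).toReal = ‖v - x‖ ^ 2 / (2 * μ) + (r v).toReal := by
  rw [moreau_eq_of_mem_prox hv, proxObj_eq_coe hr (ne_top_of_mem_prox hr hv), EReal.toReal_coe]

lemma moreau_ne_bot_of_mem_prox (hr : ProperLsc r) (hv : v ∈ prox μ r x) :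
    moreau μ r x ≠ ⊥ := by
  rw [moreau_eq_of_mem_prox hv, proxObj_eq_coe hr (ne_top_of_mem_prox hr hv)]
  exact EReal.coe_ne_bot _

lemma moreau_toReal_le (hr : ProperLsc r) (hbot : moreau μ r x ≠ ⊥) (hy : r y ≠ ⊤) :
    (moreau μ r x).toReal ≤ ‖y - x‖ ^ 2 / (2 * μ) + (r y).toReal := by
  have h1 : moreau μ r x ≤ ((‖y - x‖ ^ 2 / (2 * μ) + (r y).toReal : ℝ) : EReal) := by
    rw [← proxObj_eq_coe hr hy]; exact iInf_le _ y
  have := EReal.toReal_le_toReal h1 hbot (EReal.coe_ne_top _)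
  rwa [EReal.toReal_coe] at this

lemma le_moreau {m : ℝ} (hμ : 0 ≤ μ) (hm : ∀ x, (m : EReal) ≤ r x) (x : Vec d) :
    (m : EReal) ≤ moreau μ r x := by
  refine le_iInf fun y => (hm y).trans ?_
  rw [proxObj]
  nth_rewrite 1 [← zero_add (r y)]
  gcongr
  exact_mod_cast div_nonneg (sq_nonneg _) (by positivity)

lemma moreau_ne_top (hr : ProperLsc r) (x : Vec d) : moreau μ r x ≠ ⊤ := by
  obtain ⟨y, hy⟩ := hr.1
  intro htop
  have h1 : moreau μ r x ≤ proxObj μ r x y := iInf_le _ y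
  rw [htop, proxObj_eq_coe hr hy, top_le_iff] at h1
  exact EReal.coe_ne_top _ h1

lemma LowerBounded.moreau_ne_bot (hb : LowerBounded r) (hμ : 0 ≤ μ) (x : Vec d) :
    moreau μ r x ≠ ⊥ := by
  obtain ⟨m, hm⟩ := hb
  exact ne_bot_of_le_ne_bot (EReal.coe_ne_bot m) (le_moreau hμ hm x)

lemma moreau_anti {μ₀ : ℝ} (hμ : 0 < μ) (hle : μ ≤ μ₀) (x : Vec d) :
    moreau μ₀ r x ≤ moreau μ r x := by
  refine iInf_mono fun y => ?_
  rw [proxObj, proxObj]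
  gcongr

/-- The envelope is an infimum over an uncountable family; the measurable selection `p` attains it
and expresses it by measurable functions. -/
lemma measurable_envObj (hr : ProperLsc r) (hg : Continuous g) (hh : Continuous h)
    {p : Vec d → Vec d} (hpm : Measurable p) (hp : ∀ x, p x ∈ prox μ r x) :
    Measurable (envObj g h r μ) := by
  have h1 : envObj g h r μ =
      fun x => g x - h x + (‖p x - x‖ ^ 2 / (2 * μ) + (r (p x)).toReal) := by
    funext x
    rw [envObj, moreau_toReal_of_mem_prox hr (hp x)]
  rw [h1]
  have hrm : Measurable r := hr.2.2.measurable
  exact (hg.measurable.sub hh.measurable).add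
    ((((hpm.sub measurable_id).norm.pow_const 2).div_const _).add
      (hrm.comp hpm).ereal_toReal)

/-- The DC majorization of the smoothed objective at the center `c` of a stage. -/
lemma envObj_sub_le (hr : ProperLsc r) (hh_conv : ConvexOn ℝ univ h) (hh : LSmooth L h)
    (hμ : 0 < μ) (hγ : 0 ≤ γ) (hv : v ∈ prox μ r c) (hx : (prox μ r x).Nonempty) :
    envObj g h r μ x - envObj g h r μ c ≤
      stageObj g μ γ (gradient h c + μ⁻¹ • v) c x -
        stageObj g μ γ (gradient h c + μ⁻¹ • v) c c := by
  obtain ⟨w, hw⟩ := hx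
  -- Using `v` as a competitor at `x` amounts to the subgradient inequality for `R_μ` at `c`; after
  -- subtraction of `‖·‖²/(2μ)` only a linear term in `v` remains, as `h4` records.
  have h1 := moreau_toReal_le hr (moreau_ne_bot_of_mem_prox hr hw) (ne_top_of_mem_prox hr hv)
  have h2 := moreau_toReal_of_mem_prox hr hv
  have h3 := gradient_le_of_convexOn hh_conv hh.1 c x
  have h4 : ‖v - x‖ ^ 2 / (2 * μ) - ‖v - c‖ ^ 2 / (2 * μ) =
      ‖x‖ ^ 2 / (2 * μ) - ‖c‖ ^ 2 / (2 * μ) - μ⁻¹ * (inner ℝ v x - inner ℝ v c) := by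
    rw [norm_sub_sq_real, norm_sub_sq_real]
    field_simp
    ring
  simp only [envObj, stageObj, quadReg, h2, inner_add_left, inner_smul_left, conj_trivial]
  rw [inner_sub_right] at h3
  have h5 : 0 ≤ γ / 2 * ‖x - c‖ ^ 2 := by positivity
  simp only [sub_self, norm_zero]
  linarith

lemma sq_norm_sub_le_gap (hr : ProperLsc r) (hg_conv : ConvexOn ℝ univ g) (hg : LSmooth L g)
    (hh_conv : ConvexOn ℝ univ h) (hh : LSmooth L h)
    (hμ : 0 < μ) (hγ : 0 ≤ γ) (hv : v ∈ prox μ r c) (hx : (prox μ r x).Nonempty)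
    (hz : gradient g z + (μ⁻¹ + γ) • z = (gradient h c + μ⁻¹ • v) + γ • c) :
    envObj g h r μ x + (μ⁻¹ + γ) / 2 * ‖c - z‖ ^ 2 ≤ envObj g h r μ c +
      (stageObj g μ γ (gradient h c + μ⁻¹ • v) c x -
        stageObj g μ γ (gradient h c + μ⁻¹ • v) c z) := by
  have h1 := envObj_sub_le (g := g) hr hh_conv hh hμ hγ hv hx
  have h2 := stageObj_lower hg_conv hg hz c
  linarith

lemma inv_smul_sub_mem_frechetSubdiff (hr : ProperLsc r) (hμ : 0 < μ) (hv : v ∈ prox μ r x) :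
    μ⁻¹ • (x - v) ∈ frechetSubdiff r v := by
  have htop := ne_top_of_mem_prox hr hv
  refine ⟨htop, hr.ne_bot v, fun δ hδ => ?_⟩
  -- The minimality of `v` leaves the error `‖y - v‖ ^ 2 / (2 * μ)`, which is at most `δ * ‖y - v‖`
  -- within radius `2 * μ * δ`.
  filter_upwards [Metric.ball_mem_nhds v (show 0 < 2 * μ * δ by positivity)] with y hy
  rcases eq_or_ne (r y) ⊤ with hy' | hy'
  · rw [hy']; exact le_top
  have h1 := hv y
  rw [proxObj_eq_coe hr htop, proxObj_eq_coe hr hy', EReal.coe_le_coe_iff] at h1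
  rw [← EReal.coe_toReal hy' (hr.ne_bot y), ← EReal.coe_toReal htop (hr.ne_bot v),
    ← EReal.coe_add, EReal.coe_le_coe_iff]
  rw [mem_ball_iff_norm] at hy
  have h2 : ‖y - x‖ ^ 2 / (2 * μ) - ‖v - x‖ ^ 2 / (2 * μ) =
      ‖y - v‖ ^ 2 / (2 * μ) - inner ℝ (μ⁻¹ • (x - v)) (y - v) := by
    have : y - x = (y - v) - (x - v) := by abel
    rw [this, norm_sub_sq_real, inner_smul_left, real_inner_comm (y - v), norm_sub_rev v x]
    simp only [conj_trivial]
    field_simp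
    ring
  have h3 : ‖y - v‖ ^ 2 / (2 * μ) ≤ δ * ‖y - v‖ := by
    rw [div_le_iff₀ (by positivity)]
    nlinarith [norm_nonneg (y - v)]
  linarith

/-- The subgradient `μ⁻¹ • (x - v)` is tested in the distance, and the stationarity equation `hz`
replaces its part in `v`. What remains are two gradient differences, between `v` and `x` and between
`z` and `v`, and a multiple of `x - z`. -/
lemma critDist_le (hr : ProperLsc r) (hg : LSmooth L g) (hh : LSmooth L h)
    (hL : 0 < L) (hμ : 0 < μ) (hγ : 0 ≤ γ) (hv : v ∈ prox μ r x)
    (hz : gradient g z + (μ⁻¹ + γ) • z = (gradient h x + μ⁻¹ • v) + γ • x) :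
    critDist g h r v ≤
      ENNReal.ofReal (2 * L * ‖x - v‖ + (L + γ + μ⁻¹) * ‖x - z‖) := by
  have h1 : critDist g h r v ≤ edist (gradient h v) (gradient g v + μ⁻¹ • (x - v)) :=
    Metric.infEDist_le_edist_of_mem
      ⟨_, inv_smul_sub_mem_frechetSubdiff hr hμ hv, rfl⟩
  refine h1.trans ?_
  rw [edist_dist]
  refine ENNReal.ofReal_le_ofReal ?_
  rw [dist_eq_norm]
  have h2 : gradient h v - (gradient g v + μ⁻¹ • (x - v)) =
      (gradient h v - gradient h x) + (gradient g z - gradient g v) + (-(γ + μ⁻¹)) • (x - z) := by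
    have : gradient g z = (gradient h x + μ⁻¹ • v) + γ • x - (μ⁻¹ + γ) • z :=
      eq_sub_of_add_eq hz
    rw [this]
    module
  rw [h2]
  have h3 := hh.2 v x
  have h4 := hg.2 z v
  have h5 : ‖(-(γ + μ⁻¹)) • (x - z)‖ = (γ + μ⁻¹) * ‖x - z‖ := by
    rw [norm_smul, norm_neg, Real.norm_eq_abs, abs_of_nonneg (by positivity)]
  have h6 := norm_add₃_le (a := gradient h v - gradient h x) (b := gradient g z - gradient g v)
    (c := (-(γ + μ⁻¹)) • (x - z))
  have h7 : ‖z - v‖ ≤ ‖x - z‖ + ‖x - v‖ := by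
    have : z - v = (x - v) - (x - z) := by abel
    rw [this]
    linarith [norm_sub_le (x - v) (x - z)]
  rw [norm_sub_rev v x] at h3
  nlinarith [mul_le_mul_of_nonneg_left h7 hL.le]

/-- Comparison of `v` with the competitor `x` bounds `‖x - v‖ ^ 2 / (2 * μ)` by `r x - r v`, hence
by `G * ‖x - v‖`. -/
lemma norm_sub_prox_le_of_lipschitz {ρ : Vec d → ℝ} {G : NNReal} (hρ : ∀ x, r x = (ρ x : EReal))
    (hG : LipschitzWith G ρ) (hμ : 0 < μ) (hv : v ∈ prox μ r x) : ‖x - v‖ ≤ 2 * μ * G := by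
  have h1 := hv x
  rw [proxObj, proxObj, hρ, hρ, ← EReal.coe_add, ← EReal.coe_add, EReal.coe_le_coe_iff] at h1
  have h2 := hG.dist_le_mul x v
  rw [Real.dist_eq, dist_eq_norm] at h2
  have h3 := le_abs_self (ρ x - ρ v)
  simp only [sub_self, norm_zero, ne_eq, OfNat.ofNat_ne_zero, not_false_eq_true, zero_pow,
    zero_div, zero_add] at h1
  rw [norm_sub_rev v x] at h1
  rcases (norm_nonneg (x - v)).eq_or_lt with h0 | h0
  · rw [← h0]; positivity
  · have h4 : ‖x - v‖ ^ 2 / (2 * μ) ≤ G * ‖x - v‖ := by linarith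
    rw [div_le_iff₀ (by positivity)] at h4
    nlinarith

/-- The point `v` is optimal for `μ` and admissible for `μ₀`. Since `2 * μ ≤ μ₀`, the two envelopes
at `x` differ by at least `‖x - v‖ ^ 2 / (4 * μ)`. The envelope objective for `μ₀` is at least its
value at `x₁` minus `Δ`, so the difference is controlled by the gap for `μ` at `x`. -/
lemma sq_norm_sub_prox_le_of_gap {μ₀ Δ : ℝ} {x₁ : Vec d} (hr : ProperLsc r) (hb : LowerBounded r)
    (hx₁ : r x₁ ≠ ⊤) (hμ₀ : 0 < μ₀)
    (hgap : ∀ y, envObj g h r μ₀ x₁ - envObj g h r μ₀ y ≤ Δ) (hμ : 0 < μ) (hle : 2 * μ ≤ μ₀)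
    (hv : v ∈ prox μ r x) (hv₁ : (prox μ r x₁).Nonempty) :
    ‖x - v‖ ^ 2 ≤ 4 * μ * (envObj g h r μ x - envObj g h r μ x₁ + Δ +
      ((r x₁).toReal - (moreau μ₀ r x₁).toReal)) := by
  obtain ⟨w, hw⟩ := hv₁
  have h1 := hgap x
  have h2 := moreau_toReal_le hr (hb.moreau_ne_bot hμ₀.le x) (ne_top_of_mem_prox hr hv)
  have h3 := moreau_toReal_of_mem_prox hr hv
  have h4 := moreau_toReal_le hr (moreau_ne_bot_of_mem_prox hr hw) hx₁
  simp only [sub_self, norm_zero, ne_eq, OfNat.ofNat_ne_zero, not_false_eq_true, zero_pow,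
    zero_div, zero_add] at h4
  have h5 : ‖v - x‖ ^ 2 / (2 * μ₀) ≤ ‖v - x‖ ^ 2 / (4 * μ) :=
    div_le_div_of_nonneg_left (sq_nonneg _) (by positivity) (by linarith)
  have h6 : ‖v - x‖ ^ 2 / (2 * μ) = 2 * (‖v - x‖ ^ 2 / (4 * μ)) := by field_simp; ring
  simp only [envObj] at *
  rw [norm_sub_rev, ← div_le_iff₀' (by positivity)]
  linarith

/-- The envelope increases as `μ` decreases, so a lower bound for the single parameter `μ₀` serves
all smaller ones. On the compact closure of a sublevel set `g - h` attains a minimum and the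
envelope is at least `m`; continuity of the envelope is not needed. At `x₁` the envelope is at most
`r x₁` for every `μ`. -/
lemma initialGap_of_regLevelBounded {x₁ : Vec d} (hr : ProperLsc r) (hg : Continuous g)
    (hh : Continuous h) (hx₁ : r x₁ ≠ ⊤) (hlev : RegLevelBounded g h r) :
    InitialGap g h r x₁ := by
  obtain ⟨⟨μ₀, hμ₀, hlev⟩, -, hb⟩ := hlev
  obtain ⟨m, hm⟩ := id hb
  set A := {x | envObj g h r μ₀ x ≤ envObj g h r μ₀ x₁} with hA
  have hK : IsCompact (closure A) := (hlev _).isCompact_closure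
  obtain ⟨w, -, hw⟩ := hK.exists_isMinOn ⟨x₁, subset_closure (by simp [hA])⟩
    (hg.sub hh).continuousOn
  have hmor : ∀ x, m ≤ (moreau μ₀ r x).toReal := fun x => by
    have := EReal.toReal_le_toReal (le_moreau hμ₀.1.le hm x) (EReal.coe_ne_bot _)
      (moreau_ne_top hr x)
    rwa [EReal.toReal_coe] at this
  have hlow : ∀ x, min (envObj g h r μ₀ x₁) (g w - h w + m) ≤ envObj g h r μ₀ x := by
    intro x
    by_cases hx : x ∈ A
    · have h1 : g w - h w ≤ g x - h x := hw (subset_closure hx)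
      exact (min_le_right _ _).trans (by rw [envObj]; linarith [hmor x])
    · exact (min_le_left _ _).trans (not_le.1 hx).le
  refine ⟨g x₁ - h x₁ + (r x₁).toReal - min (envObj g h r μ₀ x₁) (g w - h w + m), μ₀, hμ₀.1,
    fun μ hμ y => ?_⟩
  have h1 := moreau_toReal_le (y := x₁) hr (hb.moreau_ne_bot hμ.1.le x₁) hx₁
  simp only [sub_self, norm_zero, ne_eq, OfNat.ofNat_ne_zero, not_false_eq_true, zero_pow,
    zero_div, zero_add] at h1
  have h2 := EReal.toReal_le_toReal (moreau_anti (r := r) hμ.1 hμ.2 y)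
    (hb.moreau_ne_bot hμ₀.1.le y) (moreau_ne_top hr y)
  have h3 := hlow y
  simp only [envObj] at *
  linarith

end Prox

/-! ### Sums with polynomial weights. -/

section Weights

/-- Bernoulli's inequality for `(1 - 1/(n+1)) ^ (α + 1)` bounds the increment of `n ^ (α + 1)` by
`(α + 1) * (n + 1) ^ α`. -/
lemma rpow_add_one_le_sum_rpow {α : ℝ} (hα : 0 ≤ α) (K : ℕ) :
    (K : ℝ) ^ (α + 1) ≤ (α + 1) * ∑ j ∈ Finset.Icc 1 K, (j : ℝ) ^ α := by
  induction K with
  | zero => simp [Real.zero_rpow (by linarith : α + 1 ≠ 0)]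
  | succ n ih =>
    rw [Finset.sum_Icc_succ_top (by omega), mul_add]
    have hn : (0 : ℝ) < (n + 1 : ℕ) := by positivity
    have h1 := one_add_mul_self_le_rpow_one_add (s := -(1 / (n + 1 : ℕ))) (p := α + 1)
      (by rw [neg_le_neg_iff, div_le_one hn]; push_cast; linarith [n.cast_nonneg (α := ℝ)])
      (by linarith)
    have h2 : (n : ℝ) = (n + 1 : ℕ) * (1 + -(1 / (n + 1 : ℕ))) := by
      field_simp; push_cast; ring
    have h3 : (n : ℝ) ^ (α + 1) =
        ((n + 1 : ℕ) : ℝ) ^ (α + 1) * (1 + -(1 / (n + 1 : ℕ))) ^ (α + 1) := by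
      rw [← Real.mul_rpow hn.le, ← h2]
      have : 1 / ((n + 1 : ℕ) : ℝ) ≤ 1 := by
        rw [div_le_one hn]; push_cast; linarith [n.cast_nonneg (α := ℝ)]
      linarith
    have h4 : ((n + 1 : ℕ) : ℝ) ^ (α + 1) = ((n + 1 : ℕ) : ℝ) ^ α * (n + 1 : ℕ) := by
      rw [Real.rpow_add hn, Real.rpow_one]
    have h5 := mul_le_mul_of_nonneg_left h1 (Real.rpow_nonneg hn.le (α + 1))
    rw [← h3] at h5
    have h6 : ((n + 1 : ℕ) : ℝ) ^ (α + 1) * (1 + (α + 1) * -(1 / (n + 1 : ℕ))) =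
        ((n + 1 : ℕ) : ℝ) ^ (α + 1) - (α + 1) * ((n + 1 : ℕ) : ℝ) ^ α := by
      rw [h4]; field_simp; ring
    linarith

/-- Summation by parts for a weighted sum of successive decrements. -/
lemma sum_rpow_mul_sub_add_le {α B : ℝ} (hα : 0 ≤ α) {δ : ℕ → ℝ} {K : ℕ} (hK : 1 ≤ K)
    (hB : ∀ k ∈ Finset.Icc 1 K, δ k ≤ B) :
    ∑ k ∈ Finset.Icc 1 K, (k : ℝ) ^ α * (δ k - δ (k + 1)) + (K : ℝ) ^ α * δ (K + 1) ≤
      (K : ℝ) ^ α * B := by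
  induction K, hK using Nat.le_induction with
  | base => simpa using hB 1 (by simp)
  | succ n hn ih =>
    rw [Finset.sum_Icc_succ_top (by omega)]
    have h1 := ih fun k hk => hB k (Finset.Icc_subset_Icc_right (by omega) hk)
    have h2 := hB (n + 1) (by simp)
    have h3 : (n : ℝ) ^ α ≤ ((n + 1 : ℕ) : ℝ) ^ α :=
      Real.rpow_le_rpow (by positivity) (by push_cast; linarith) hα
    nlinarith [mul_le_mul_of_nonneg_left h2 (sub_nonneg.2 h3)]

/-- Summation by parts bounds the left side by a multiple of the last weight `K ^ α`, which is at
most `(α + 1) / K` times the total weight. This is the source of the rate `1/K`. -/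
lemma sum_rpow_mul_le_of_descent {α κ B B' : ℝ} (hα : 0 ≤ α) (hκ : 0 < κ)
    {δ a θ : ℕ → ℝ} {K : ℕ} (hK : 1 ≤ K) (hB : ∀ k ∈ Finset.Icc 1 K, δ k ≤ B)
    (hδ : 0 ≤ δ (K + 1)) (hdesc : ∀ k ∈ Finset.Icc 1 K, κ * a k ≤ δ k - δ (k + 1) + θ k)
    (hθ : ∑ k ∈ Finset.Icc 1 K, (k : ℝ) ^ α * θ k ≤ (K : ℝ) ^ α * B')
    (hBB : 0 ≤ B + B') :
    ∑ k ∈ Finset.Icc 1 K, (k : ℝ) ^ α * a k ≤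
      (α + 1) * (B + B') / κ / K * ∑ k ∈ Finset.Icc 1 K, (k : ℝ) ^ α := by
  have hK0 : (0 : ℝ) < K := by exact_mod_cast hK
  have h1 := sum_rpow_mul_sub_add_le hα hK hB
  have h2 : κ * ∑ k ∈ Finset.Icc 1 K, (k : ℝ) ^ α * a k ≤
      ∑ k ∈ Finset.Icc 1 K, (k : ℝ) ^ α * (δ k - δ (k + 1)) +
        ∑ k ∈ Finset.Icc 1 K, (k : ℝ) ^ α * θ k := by
    rw [Finset.mul_sum, ← Finset.sum_add_distrib]
    refine Finset.sum_le_sum fun k hk => ?_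
    have := mul_le_mul_of_nonneg_left (hdesc k hk) (Real.rpow_nonneg k.cast_nonneg α)
    linarith
  have h3 : 0 ≤ (K : ℝ) ^ α * δ (K + 1) := mul_nonneg (Real.rpow_nonneg hK0.le _) hδ
  have h4 := rpow_add_one_le_sum_rpow hα K
  rw [Real.rpow_add hK0, Real.rpow_one] at h4
  rw [div_div, div_mul_eq_mul_div, le_div_iff₀ (by positivity)]
  have h5 := mul_le_mul_of_nonneg_right h4 hBB
  have h6 : κ * ∑ k ∈ Finset.Icc 1 K, (k : ℝ) ^ α * a k ≤ (K : ℝ) ^ α * (B + B') := by linarith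
  nlinarith [mul_le_mul_of_nonneg_right h6 hK0.le]

end Weights

/-! ### Expectation at the random output index. -/

section Sampling

variable {Ω : Type*} [mΩ : MeasurableSpace Ω] {P : Measure Ω} [IsProbabilityMeasure P]

lemma sum_rpow_pos {α : ℝ} {K : ℕ} (hK : 1 ≤ K) :
    0 < ∑ j ∈ Finset.Icc 1 K, (j : ℝ) ^ α :=
  Finset.sum_pos (fun j hj => Real.rpow_pos_of_pos
    (by exact_mod_cast (Finset.mem_Icc.1 hj).1) _) ⟨1, by simp [hK]⟩

lemma PowerSampled.ae_mem {α : ℝ} {K : ℕ} {τ : Ω → ℕ} (hτ : PowerSampled P α K τ)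
    (hK : 1 ≤ K) : P {ω | τ ω ∉ Finset.Icc 1 K} = 0 := by
  have hW := sum_rpow_pos (α := α) hK
  have h1 : P {ω | τ ω ∈ Finset.Icc 1 K} = 1 := by
    have h2 : {ω | τ ω ∈ Finset.Icc 1 K} = ⋃ k ∈ Finset.Icc 1 K, {ω | τ ω = k} := by
      ext ω; simp
    rw [h2, measure_biUnion_finset]
    · rw [Finset.sum_congr rfl hτ.2, ← ENNReal.ofReal_sum_of_nonneg, ← Finset.sum_div,
        div_self hW.ne', ENNReal.ofReal_one]
      exact fun k _ => div_nonneg (Real.rpow_nonneg k.cast_nonneg _) hW.le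
    · intro i _ j _ hij
      exact Set.disjoint_left.2 fun ω hi hj => hij (hi.symm.trans hj)
    · exact fun k _ => hτ.1 (measurableSet_singleton k)
  have h3 : MeasurableSet {ω | τ ω ∈ Finset.Icc 1 K} :=
    hτ.1 (Finset.measurableSet (Finset.Icc 1 K))
  exact (prob_compl_eq_zero_iff h3).2 h1

/-- On `τ = k` the function is at most `φ k`, which depends on the samples only. Independence of `τ`
from `m` factors each expectation into `ℙ(τ = k)` and the mean of `φ k`. -/
lemma expectLE_of_powerSampled {Ω : Type*} {m mΩ : MeasurableSpace Ω} {P : Measure Ω}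
    [IsProbabilityMeasure P] {α b : ℝ} {K : ℕ} {τ : Ω → ℕ} (hτ : PowerSampled P α K τ)
    (hK : 1 ≤ K) (hm : m ≤ mΩ)
    (hind : Indep (MeasurableSpace.comap τ inferInstance) m P)
    {f : Ω → ℝ≥0∞} {φ : ℕ → Ω → ℝ} (hφ : ∀ k ∈ Finset.Icc 1 K, Measurable[m] (φ k))
    (hφ0 : ∀ k ∈ Finset.Icc 1 K, ∀ ω, 0 ≤ φ k ω)
    (hφi : ∀ k ∈ Finset.Icc 1 K, Integrable (φ k) P)
    (hf : ∀ k ∈ Finset.Icc 1 K, ∀ ω, τ ω = k → f ω ≤ ENNReal.ofReal (φ k ω))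
    (hb : ∑ k ∈ Finset.Icc 1 K, (k : ℝ) ^ α * ∫ ω, φ k ω ∂P ≤
      b * ∑ k ∈ Finset.Icc 1 K, (k : ℝ) ^ α) : ExpectLE P f b := by
  have hW := sum_rpow_pos (α := α) hK
  have hset : ∀ k, MeasurableSet {ω | τ ω = k} := fun k => hτ.1 (measurableSet_singleton k)
  have hnot : MeasurableSet {ω | τ ω ∉ Finset.Icc 1 K} :=
    (hτ.1 (Finset.measurableSet (Finset.Icc 1 K))).compl
  have hmeas : ∀ k ∈ Finset.Icc 1 K, Measurable fun ω =>
      ({ω | τ ω = k}.indicator (fun _ => (1 : ℝ≥0∞)) ω * ENNReal.ofReal (φ k ω)) := fun k hk =>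
    (measurable_const.indicator (hset k)).mul ((hφ k hk).mono hm le_rfl).ennreal_ofReal
  -- Nothing is known about `f` where `τ` leaves `{1, …, K}`; the majorant is infinite on this null
  -- set.
  refine ⟨fun ω => ∑ k ∈ Finset.Icc 1 K,
      {ω | τ ω = k}.indicator (fun _ => (1 : ℝ≥0∞)) ω * ENNReal.ofReal (φ k ω) +
      {ω | τ ω ∉ Finset.Icc 1 K}.indicator (fun _ => ⊤) ω, ?_, fun ω => ?_, ?_⟩
  · exact (Finset.measurable_fun_sum _ hmeas).add (measurable_const.indicator hnot)
  · by_cases hω : τ ω ∈ Finset.Icc 1 K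
    · refine le_trans ?_ (self_le_add_right _ _)
      refine le_trans ?_ (Finset.single_le_sum (fun _ _ => zero_le) hω)
      simpa using hf (τ ω) hω ω rfl
    · simp only [mem_ofPred_eq, hω, not_false_eq_true, indicator_of_mem, add_top, le_top]
  · rw [lintegral_add_right _ (measurable_const.indicator hnot), lintegral_indicator hnot,
      setLIntegral_const, hτ.ae_mem hK, mul_zero, add_zero,
      lintegral_finsetSum _ hmeas]
    have hk : ∀ k ∈ Finset.Icc 1 K, ∫⁻ ω, {ω | τ ω = k}.indicator (fun _ => (1 : ℝ≥0∞)) ω *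
        ENNReal.ofReal (φ k ω) ∂P = ENNReal.ofReal
          ((k : ℝ) ^ α * (∫ ω, φ k ω ∂P) / ∑ j ∈ Finset.Icc 1 K, (j : ℝ) ^ α) := by
      intro k hk
      have hcomap : MeasurableSet[MeasurableSpace.comap τ inferInstance] {ω | τ ω = k} :=
        ⟨{k}, measurableSet_singleton k, rfl⟩
      rw [lintegral_mul_eq_lintegral_mul_lintegral_of_independent_measurableSpace
        hτ.1.comap_le hm hind
        (measurable_const.indicator hcomap)
        (hφ k hk).ennreal_ofReal, lintegral_indicator (hset k), setLIntegral_const, one_mul,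
        hτ.2 k hk, ← ofReal_integral_eq_lintegral_ofReal (hφi k hk)
          (Filter.Eventually.of_forall (hφ0 k hk)), ← ENNReal.ofReal_mul
          (div_nonneg (Real.rpow_nonneg k.cast_nonneg _) hW.le)]
      congr 1
      ring
    rw [Finset.sum_congr rfl hk, ← ENNReal.ofReal_sum_of_nonneg, ← Finset.sum_div]
    · exact ENNReal.ofReal_le_ofReal ((div_le_iff₀ hW).2 hb)
    · exact fun k hk => div_nonneg (mul_nonneg (Real.rpow_nonneg k.cast_nonneg _)
        (integral_nonneg (hφ0 k hk))) hW.le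

end Sampling

/-- The minimizer of the majorant of a stage with center `c`, in terms of the inverse `J` of
`∇g + (1/μ + γ)`. -/
noncomputable def stagePoint {d : ℕ} (h : Vec d → ℝ) (μ γ : ℝ) (p J : Vec d → Vec d)
    (c : Vec d) : Vec d :=
  J ((gradient h c + μ⁻¹ • p c) + γ • c)

/-- The gap of the smoothed objective over the lower bound `F_μ(x₁) - Δ`. -/
noncomputable def envGap {d : ℕ} (g h : Vec d → ℝ) (r : Vec d → EReal) (μ : ℝ) (x₁ : Vec d)
    (Δ : ℝ) (x : Vec d) : ℝ :=
  envObj g h r μ x - envObj g h r μ x₁ + Δ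

/-- The factor of `ε` in the final guarantee: `A` bounds the squared distance to the proximal point,
`B` the expected gaps, and `B'` the accumulated errors of the stages. -/
noncomputable def rateConst (L γ α A B B' : ℝ) : ℝ :=
  (1 + 2 * L) * ((1 + A * (B + 1)) / 2) +
    (L + γ + 1) * ((1 + (α + 1) * (B + B') / (γ / 4)) / 2)

lemma rateConst_pos {L γ α A B B' : ℝ} (hL : 0 < L) (hγ : 0 < γ) (hα : 0 ≤ α) (hA : 0 ≤ A)
    (hB : 0 ≤ B) (hB' : 0 ≤ B') : 0 < rateConst L γ α A B B' := by
  unfold rateConst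
  positivity

/-- The smoothed problem at a fixed parameter `μ`: the standing assumptions, a measurable selection
`p` of the proximal mapping, and the inverse `J` of `∇g + (1/μ + γ)`. -/
structure SmoothedDC {d : ℕ} (g h : Vec d → ℝ) (r : Vec d → EReal) (L μ γ : ℝ) (x₁ : Vec d)
    (Δ : ℝ) (p J : Vec d → Vec d) : Prop where
  L_pos : 0 < L
  μ_pos : 0 < μ
  γ_pos : 0 < γ
  g_convex : ConvexOn ℝ univ g
  h_convex : ConvexOn ℝ univ h
  g_smooth : LSmooth L g
  h_smooth : LSmooth L h
  r_properLsc : ProperLsc r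
  p_measurable : Measurable p
  p_mem : ∀ x, p x ∈ prox μ r x
  gap : ∀ y, envObj g h r μ x₁ - envObj g h r μ y ≤ Δ
  J_continuous : Continuous J
  J_spec : ∀ w, gradient g (J w) + (μ⁻¹ + γ) • J w = w

/-! ### Descent of the smoothed objective and the guarantee it implies. -/

namespace SmoothedDC

variable {d : ℕ} {g h : Vec d → ℝ} {r : Vec d → EReal} {L μ γ Δ : ℝ} {x₁ : Vec d}
  {p J : Vec d → Vec d}

lemma measurable_stagePoint (S : SmoothedDC g h r L μ γ x₁ Δ p J) :
    Measurable (stagePoint h μ γ p J) :=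
  S.J_continuous.measurable.comp
    ((S.h_smooth.continuous_gradient.measurable.add (S.p_measurable.const_smul μ⁻¹)).add
      (measurable_id.const_smul γ))

lemma measurable_envGap (S : SmoothedDC g h r L μ γ x₁ Δ p J) :
    Measurable (envGap g h r μ x₁ Δ) :=
  ((measurable_envObj S.r_properLsc S.g_smooth.1.continuous S.h_smooth.1.continuous
    S.p_measurable S.p_mem).sub_const _).add_const _

lemma envGap_nonneg (S : SmoothedDC g h r L μ γ x₁ Δ p J) (x : Vec d) :
    0 ≤ envGap g h r μ x₁ Δ x := by
  have := S.gap x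
  simp only [envGap]
  linarith

lemma envGap_self : envGap g h r μ x₁ Δ x₁ = Δ := by simp [envGap]

lemma stagePoint_spec (S : SmoothedDC g h r L μ γ x₁ Δ p J) (c : Vec d) :
    gradient g (stagePoint h μ γ p J c) + (μ⁻¹ + γ) • stagePoint h μ γ p J c =
      (gradient h c + μ⁻¹ • p c) + γ • c :=
  S.J_spec _

/-- The decrease of the smoothed objective, up to the optimization error of the stage. -/
lemma envGap_descent (S : SmoothedDC g h r L μ γ x₁ Δ p J) (c x : Vec d) :
    envGap g h r μ x₁ Δ x + γ / 2 * ‖c - stagePoint h μ γ p J c‖ ^ 2 ≤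
      envGap g h r μ x₁ Δ c + (stageObj g μ γ (gradient h c + μ⁻¹ • p c) c x -
        stageObj g μ γ (gradient h c + μ⁻¹ • p c) c (stagePoint h μ γ p J c)) := by
  have h1 := sq_norm_sub_le_gap S.r_properLsc S.g_convex S.g_smooth S.h_convex S.h_smooth S.μ_pos
    S.γ_pos.le (S.p_mem c) ⟨_, S.p_mem x⟩ (S.stagePoint_spec c)
  -- The part `1/μ` of the strong convexity is given up; the remaining modulus `γ` does not depend
  -- on `μ`.
  have h2 : 0 ≤ μ⁻¹ / 2 * ‖c - stagePoint h μ γ p J c‖ ^ 2 := by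
    have := S.μ_pos
    positivity
  simp only [envGap]
  linarith

/-- The descent inequality applied to the exact minimizer, whose optimization error vanishes and
whose gap is nonnegative. -/
lemma sq_norm_sub_stagePoint_le (S : SmoothedDC g h r L μ γ x₁ Δ p J) (c : Vec d) :
    γ / 2 * ‖c - stagePoint h μ γ p J c‖ ^ 2 ≤ envGap g h r μ x₁ Δ c := by
  have h1 := S.envGap_descent c (stagePoint h μ γ p J c)
  have h2 := S.envGap_nonneg (stagePoint h μ γ p J c)
  linarith

variable {Ω : Type*} {m mΩ : MeasurableSpace Ω} {P : Measure Ω}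

lemma integrable_sq_norm_sub_stagePoint (S : SmoothedDC g h r L μ γ x₁ Δ p J)
    {x : Ω → Vec d} (hx : Measurable x)
    (hi : Integrable (fun ω => envGap g h r μ x₁ Δ (x ω)) P) :
    Integrable (fun ω => ‖x ω - stagePoint h μ γ p J (x ω)‖ ^ 2) P := by
  refine (hi.const_mul (2 / γ)).mono'
    ((hx.sub (S.measurable_stagePoint.comp hx)).norm.pow_const 2).aestronglyMeasurable
    (Filter.Eventually.of_forall fun ω => ?_)
  have h1 := S.sq_norm_sub_stagePoint_le (x ω)
  have h2 := S.γ_pos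
  rw [Real.norm_eq_abs, abs_of_nonneg (sq_nonneg _), div_mul_eq_mul_div, le_div_iff₀ h2]
  linarith

/-- The guarantee for the randomly sampled stage, from the descent of the expected gaps. -/
theorem nearlyCritical [IsProbabilityMeasure P] {α A B B' ε : ℝ} {a K : ℕ} (S : SmoothedDC g h r L (ε ^ a) γ x₁ Δ p J)
    (hε : ε ∈ Ioc (0 : ℝ) 1) (hα : 0 ≤ α) (hK : 1 / ε ^ (2 * (a + 1)) ≤ (K : ℝ))
    (hA : 0 ≤ A) (hB0 : 0 ≤ B) (hB0' : 0 ≤ B')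
    (hpx : ∀ x, ‖x - p x‖ ^ 2 ≤ A * ε ^ 2 * (envGap g h r (ε ^ a) x₁ Δ x + 1))
    {x : ℕ → Ω → Vec d} {τ : Ω → ℕ} (hτ : PowerSampled P α K τ) (hm : m ≤ mΩ)
    (hind : Indep (MeasurableSpace.comap τ inferInstance) m P)
    (hx : ∀ k ∈ Finset.Icc 1 K, Measurable[m] (x k))
    (hi : ∀ k ∈ Finset.Icc 1 K, Integrable (fun ω => envGap g h r (ε ^ a) x₁ Δ (x k ω)) P)
    (hB : ∀ k ∈ Finset.Icc 1 K, ∫ ω, envGap g h r (ε ^ a) x₁ Δ (x k ω) ∂P ≤ B)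
    {θ : ℕ → ℝ} (hdesc : ∀ k ∈ Finset.Icc 1 K,
      γ / 4 * ∫ ω, ‖x k ω - stagePoint h (ε ^ a) γ p J (x k ω)‖ ^ 2 ∂P ≤
        ∫ ω, envGap g h r (ε ^ a) x₁ Δ (x k ω) ∂P -
          ∫ ω, envGap g h r (ε ^ a) x₁ Δ (x (k + 1) ω) ∂P + θ k)
    (hθ : ∑ k ∈ Finset.Icc 1 K, (k : ℝ) ^ α * θ k ≤ (K : ℝ) ^ α * B') :
    NearlyCritical P g h r p x τ (rateConst L γ α A B B' * ε) := by
  unfold rateConst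
  have hε0 := hε.1
  have hL := S.L_pos
  have hγ := S.γ_pos
  have hK0 : (0 : ℝ) < K := lt_of_lt_of_le (by positivity) hK
  have hK1 : 1 ≤ K := by exact_mod_cast hK0
  set C₁ := (α + 1) * (B + B') / (γ / 4) with hC₁
  have hC₁0 : 0 ≤ C₁ := by positivity
  set W := ∑ k ∈ Finset.Icc 1 K, (k : ℝ) ^ α with hW
  have hW0 : 0 < W := sum_rpow_pos hK1
  set D := fun k ω => envGap g h r (ε ^ a) x₁ Δ (x k ω) with hD
  set Z := fun k ω => ‖x k ω - stagePoint h (ε ^ a) γ p J (x k ω)‖ ^ 2 with hZ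
  have hD0 : ∀ k ω, 0 ≤ D k ω := fun k ω => S.envGap_nonneg _
  have hDm : ∀ k ∈ Finset.Icc 1 K, Measurable[m] (D k) := fun k hk =>
    S.measurable_envGap.comp (hx k hk)
  have hZm : ∀ k ∈ Finset.Icc 1 K, Measurable[m] (Z k) := fun k hk =>
    (((measurable_id.sub S.measurable_stagePoint).norm.pow_const 2).comp (hx k hk))
  have hZi : ∀ k ∈ Finset.Icc 1 K, Integrable (Z k) P := fun k hk =>
    S.integrable_sq_norm_sub_stagePoint ((hx k hk).mono hm le_rfl) (hi k hk)
  have hsum : ∑ k ∈ Finset.Icc 1 K, (k : ℝ) ^ α * ∫ ω, Z k ω ∂P ≤ C₁ * ε ^ (2 * (a + 1)) * W := by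
    have h1 := sum_rpow_mul_le_of_descent (δ := fun k => ∫ ω, D k ω ∂P)
      (a := fun k => ∫ ω, Z k ω ∂P) hα (by positivity : 0 < γ / 4) hK1 hB
      (integral_nonneg (hD0 _)) hdesc hθ (by positivity)
    refine h1.trans (mul_le_mul_of_nonneg_right ?_ hW0.le)
    rw [div_eq_mul_inv]
    refine mul_le_mul_of_nonneg_left ?_ hC₁0
    rw [inv_le_comm₀ hK0 (by positivity), ← one_div]
    exact hK
  have hsumD : ∑ k ∈ Finset.Icc 1 K, (k : ℝ) ^ α * ∫ ω, D k ω ∂P ≤ B * W := by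
    rw [hW, Finset.mul_sum]
    refine Finset.sum_le_sum fun k hk => ?_
    rw [mul_comm B]
    exact mul_le_mul_of_nonneg_left (hB k hk) (Real.rpow_nonneg k.cast_nonneg _)
  have hsumaff : ∀ c₀ c₁ c₂ : ℝ, ∑ k ∈ Finset.Icc 1 K, (k : ℝ) ^ α *
      ∫ ω, (c₀ + c₁ * D k ω + c₂ * Z k ω) ∂P = c₀ * W +
        c₁ * ∑ k ∈ Finset.Icc 1 K, (k : ℝ) ^ α * ∫ ω, D k ω ∂P +
        c₂ * ∑ k ∈ Finset.Icc 1 K, (k : ℝ) ^ α * ∫ ω, Z k ω ∂P := by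
    intro c₀ c₁ c₂
    rw [hW, Finset.mul_sum, Finset.mul_sum, Finset.mul_sum, ← Finset.sum_add_distrib,
      ← Finset.sum_add_distrib]
    refine Finset.sum_congr rfl fun k hk => ?_
    have hI₁ : Integrable (fun ω => c₁ * D k ω) P := (hi k hk).const_mul _
    have hI₂ : Integrable (fun ω => c₀ + c₁ * D k ω) P := (integrable_const _).add hI₁
    rw [integral_add hI₂ ((hZi k hk).const_mul _), integral_add (integrable_const _) hI₁,
      integral_const_mul, integral_const_mul]
    simp only [integral_const, probReal_univ, one_smul]
    ring
  -- Young's inequality `2 * ε * t ≤ ε ^ 2 + t ^ 2` bounds the norm by an affine function of the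
  -- gap, so that only the first moment of the gap is needed.
  have hpx' : ∀ y, ‖y - p y‖ ≤ ε * (1 + A) / 2 + ε * A / 2 * envGap g h r (ε ^ a) x₁ Δ y := by
    intro y
    have h1 := hpx y
    have h2 : 0 ≤ (ε - ‖y - p y‖) ^ 2 := sq_nonneg _
    have h3 : ε * (2 * ‖y - p y‖) ≤
        ε * (ε * (1 + A) + ε * A * envGap g h r (ε ^ a) x₁ Δ y) := by linarith
    have := le_of_mul_le_mul_left h3 hε0
    linarith
  have hεa : 0 < ε ^ a := by positivity
  have hεa1 : ε ^ a ≤ 1 := pow_le_one₀ hε0.le hε.2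
  have hpow : ε ^ (a + 1) = ε ^ a * ε := pow_succ _ _
  set b := ε ^ a * ε with hb
  have hb0 : 0 < b := by positivity
  -- The same with weight `b = ε ^ (a + 1)`, the target size of `‖x - z‖`. After multiplication by
  -- `1/μ = (ε ^ a)⁻¹`, both `b` and `b⁻¹ * ε ^ (2 * (a + 1))` become `ε`.
  have hzx' : ∀ y z : Vec d, ‖y - z‖ ≤ b / 2 + b⁻¹ / 2 * ‖y - z‖ ^ 2 := by
    intro y z
    have h2 : 0 ≤ (b - ‖y - z‖) ^ 2 := sq_nonneg _
    have h3 : b / 2 + b⁻¹ / 2 * ‖y - z‖ ^ 2 - ‖y - z‖ = b⁻¹ / 2 * (b - ‖y - z‖) ^ 2 := by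
      field_simp; ring
    have : 0 ≤ b⁻¹ / 2 * (b - ‖y - z‖) ^ 2 := by positivity
    linarith
  have hlarge : 0 ≤ (L + γ + 1) * ((1 + C₁) / 2) := by positivity
  have hfirst : 0 ≤ (1 + A * (B + 1)) / 2 := by positivity
  constructor
  · refine expectLE_of_powerSampled hτ hK1 hm hind
      (φ := fun k ω => ε * (1 + A) / 2 + ε * A / 2 * D k ω + 0 * Z k ω) ?_ ?_ ?_ ?_ ?_
    · exact fun k hk => (((hDm k hk).const_mul _).const_add _).add ((hZm k hk).const_mul _)
    · intro k hk ω
      have := hD0 k ω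
      simp only [zero_mul, add_zero]
      positivity
    · exact fun k hk => ((integrable_const _).add ((hi k hk).const_mul _)).add
        ((hZi k hk).const_mul _)
    · intro k hk ω hkω
      rw [hkω, ← ofReal_norm]
      refine ENNReal.ofReal_le_ofReal ?_
      have := hpx' (x k ω)
      simp only [zero_mul, add_zero]
      exact this
    · rw [hsumaff]
      have h1 : ε * A / 2 * ∑ k ∈ Finset.Icc 1 K, (k : ℝ) ^ α * ∫ ω, D k ω ∂P ≤
          ε * A / 2 * (B * W) := mul_le_mul_of_nonneg_left hsumD (by positivity)
      have h2 : 0 ≤ (2 * L * ((1 + A * (B + 1)) / 2) + (L + γ + 1) * ((1 + C₁) / 2)) * ε * W := by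
        positivity
      linarith
  · refine expectLE_of_powerSampled hτ hK1 hm hind
      (φ := fun k ω => (2 * L * (ε * (1 + A) / 2) + (L + γ + 1) * (ε ^ a)⁻¹ * (b / 2)) +
        (2 * L * (ε * A / 2)) * D k ω +
        ((L + γ + 1) * (ε ^ a)⁻¹ * (b⁻¹ / 2)) * Z k ω) ?_ ?_ ?_ ?_ ?_
    · exact fun k hk => (((hDm k hk).const_mul _).const_add _).add ((hZm k hk).const_mul _)
    · intro k hk ω
      have h1 := hD0 k ω
      have h2 : 0 ≤ Z k ω := sq_nonneg _
      positivity
    · exact fun k hk => ((integrable_const _).add ((hi k hk).const_mul _)).add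
        ((hZi k hk).const_mul _)
    · intro k hk ω hkω
      rw [hkω]
      refine (critDist_le S.r_properLsc S.g_smooth S.h_smooth hL hεa hγ.le (S.p_mem _)
        (S.stagePoint_spec (x k ω))).trans (ENNReal.ofReal_le_ofReal ?_)
      have h1 := mul_le_mul_of_nonneg_left (hpx' (x k ω)) (by positivity : 0 ≤ 2 * L)
      have h2 := mul_le_mul_of_nonneg_left
        (hzx' (x k ω) (stagePoint h (ε ^ a) γ p J (x k ω)))
        (by positivity : 0 ≤ (L + γ + 1) * (ε ^ a)⁻¹)
      have h3 : L + γ + (ε ^ a)⁻¹ ≤ (L + γ + 1) * (ε ^ a)⁻¹ := by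
        have : 1 ≤ (ε ^ a)⁻¹ := (one_le_inv₀ hεa).2 hεa1
        nlinarith
      have h4 := mul_le_mul_of_nonneg_right h3
        (norm_nonneg (x k ω - stagePoint h (ε ^ a) γ p J (x k ω)))
      simp only [hD, hZ]
      linarith
    · rw [hsumaff]
      have h1 : 2 * L * (ε * A / 2) * ∑ k ∈ Finset.Icc 1 K, (k : ℝ) ^ α * ∫ ω, D k ω ∂P ≤
          2 * L * (ε * A / 2) * (B * W) := mul_le_mul_of_nonneg_left hsumD (by positivity)
      have h2 : (L + γ + 1) * (ε ^ a)⁻¹ * (b⁻¹ / 2) *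
          ∑ k ∈ Finset.Icc 1 K, (k : ℝ) ^ α * ∫ ω, Z k ω ∂P ≤
          (L + γ + 1) * (ε ^ a)⁻¹ * (b⁻¹ / 2) * (C₁ * ε ^ (2 * (a + 1)) * W) :=
        mul_le_mul_of_nonneg_left hsum (by positivity)
      have h3 : (L + γ + 1) * (ε ^ a)⁻¹ * (b⁻¹ / 2) * (C₁ * ε ^ (2 * (a + 1)) * W) =
          (L + γ + 1) * (C₁ / 2) * ε * W := by
        rw [mul_comm 2 (a + 1), pow_mul, hpow, hb]
        field_simp
      have h4 : (L + γ + 1) * (ε ^ a)⁻¹ * (b / 2) = (L + γ + 1) * (1 / 2) * ε := by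
        rw [hb]; field_simp
      have h5 : 0 ≤ (1 + A * (B + 1)) / 2 * ε * W := by positivity
      rw [h4]
      linarith

end SmoothedDC

/-! ### Closed form of the proximal steps. -/

section ProxStep

variable {d : ℕ} {g : Vec d → ℝ} {L μ γ η : ℝ} {u c y z v x : Vec d}

/-- The closed form of a proximal step from `y` in the direction `v`, with step size `η`. -/
noncomputable def proxStep (μ γ η : ℝ) (c y v : Vec d) : Vec d :=
  (η⁻¹ + μ⁻¹ + γ)⁻¹ • (η⁻¹ • y + γ • c - v)

lemma measurable_proxStep {Ω : Type*} {m : MeasurableSpace Ω} {c y v : Ω → Vec d}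
    (hc : Measurable c) (hy : Measurable y) (hv : Measurable v) :
    Measurable fun ω => proxStep μ γ η (c ω) (y ω) (v ω) := by
  unfold proxStep
  fun_prop

lemma eq_proxStep_of_isMinOn {f : Vec d → ℝ} {k : ℝ} (hpos : 0 < η⁻¹ + μ⁻¹ + γ)
    (hf : ∀ x, f x = inner ℝ v x + η⁻¹ / 2 * ‖x - y‖ ^ 2 + ‖x‖ ^ 2 / (2 * μ) +
      γ / 2 * ‖x - c‖ ^ 2 + k) (hx : IsMinOn f univ x) : x = proxStep μ γ η c y v := by
  refine eq_inv_smul_of_isMinOn (hy := hx) (k := η⁻¹ / 2 * ‖y‖ ^ 2 + γ / 2 * ‖c‖ ^ 2 + k) hpos fun x => ?_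
  rw [hf, norm_sub_sq_real, norm_sub_sq_real, inner_sub_left, inner_add_left, inner_smul_left,
    inner_smul_left, real_inner_comm x y, real_inner_comm x c, div_eq_mul_inv (‖x‖ ^ 2), mul_inv]
  simp only [conj_trivial]
  ring

/-- The difference of the optimality equations of the step and of `z`, in which the terms `γ • c`
cancel. The contraction of SVRG and the square integrability of the SPG iterates rest on it. -/
lemma smul_proxStep_sub (hpos : 0 < η⁻¹ + μ⁻¹ + γ)
    (hz : gradient g z + (μ⁻¹ + γ) • z = u + γ • c) :
    (η⁻¹ + μ⁻¹ + γ) • (proxStep μ γ η c y v - z) = η⁻¹ • (y - z) - (v + u - gradient g z) := by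
  rw [proxStep, smul_sub, smul_smul, mul_inv_cancel₀ hpos.ne', one_smul, eq_sub_of_add_eq hz]
  module

/-- The deviation of the SVRG direction from its value at `z` is a sum of two gradient differences,
each controlled by `L`-smoothness for whichever component is drawn. -/
lemma norm_svrg_step_le {gi : Vec d → ℝ} {xbar : Vec d} (hL : 0 < L) (hμ : 0 < μ) (hγ : 0 < γ)
    (hη : 0 < η) (hg : LSmooth L g) (hgi : LSmooth L gi)
    (hz : gradient g z + (μ⁻¹ + γ) • z = u + γ • c) :
    (η⁻¹ + μ⁻¹ + γ) * ‖proxStep μ γ η c y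
        (gradient gi y - gradient gi xbar + (gradient g xbar - u)) - z‖ ≤
      (η⁻¹ + L) * ‖y - z‖ + 2 * L * ‖xbar - z‖ := by
  have hpos : 0 < η⁻¹ + μ⁻¹ + γ := by positivity
  have h1 := congrArg norm (smul_proxStep_sub (y := y)
    (v := gradient gi y - gradient gi xbar + (gradient g xbar - u)) hpos hz)
  rw [norm_smul, Real.norm_eq_abs, abs_of_pos hpos] at h1
  rw [h1]
  have h2 : gradient gi y - gradient gi xbar + (gradient g xbar - u) + u - gradient g z =
      (gradient gi y - gradient gi xbar) + (gradient g xbar - gradient g z) := by abel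
  rw [h2]
  have h3 := norm_sub_le (η⁻¹ • (y - z))
    ((gradient gi y - gradient gi xbar) + (gradient g xbar - gradient g z))
  have h4 := norm_add_le (gradient gi y - gradient gi xbar) (gradient g xbar - gradient g z)
  have h5 := hgi.2 y xbar
  have h6 := hg.2 xbar z
  have h7 : ‖y - xbar‖ ≤ ‖y - z‖ + ‖xbar - z‖ := by
    have : y - xbar = (y - z) - (xbar - z) := by abel
    rw [this]
    exact norm_sub_le _ _
  rw [norm_smul, Real.norm_eq_abs, abs_of_pos (inv_pos.2 hη)] at h3
  nlinarith [mul_le_mul_of_nonneg_left h7 hL.le]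

end ProxStep

/-! ### SVRG: pathwise contraction and descent. -/

section SVRG

variable {d n : ℕ} {gi : Fin n → Vec d → ℝ} {g h : Vec d → ℝ} {uH : Vec d → Vec d}
  {L μ γ : ℝ} {T S : ℕ} {c z out : Vec d}

lemma svrg_step_eq (hL : 0 < L) (hμ : 0 < μ) (hγ : 0 < γ) {v y x : Vec d}
    (hx : IsMinOn (fun x => inner ℝ v (x - y) + 1 / (2 * (0.05 / L)) * ‖x - y‖ ^ 2 +
      quadReg μ x + γ / 2 * ‖x - c‖ ^ 2) univ x) : x = proxStep μ γ (0.05 / L) c y v := by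
  refine eq_proxStep_of_isMinOn (k := - inner ℝ v y) (by positivity) (fun x => ?_) hx
  have h1 : 1 / (2 * (0.05 / L)) = (0.05 / L)⁻¹ / 2 := by rw [one_div, mul_inv]; ring
  rw [inner_sub_right, h1, quadReg]
  ring

/-- When the strong convexity `1/μ` dominates the smoothness `L`, every epoch of SVRG contracts the
distance to the minimizer, whatever components are drawn. -/
lemma SVRGCall.norm_sub_le (hL : 0 < L) (hμ : 0 < μ) (hγ : 0 < γ) (hg : LSmooth L g)
    (hgi : ∀ i, LSmooth L (gi i)) (hT : 1 ≤ T) {i : ℕ → ℕ → Fin n}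
    (hz : gradient g z + (μ⁻¹ + γ) • z = uH c + γ • c) (hsmall : 3 * L ≤ μ⁻¹)
    (hcall : SVRGCall gi g uH (quadReg μ) γ (0.05 / L) T S c i out) :
    ‖out - z‖ ≤ (23 * L / (20 * L + μ⁻¹ + γ)) ^ S * ‖c - z‖ := by
  obtain ⟨xbar, y, h0, hrun, rfl⟩ := hcall
  set ρ := 23 * L / (20 * L + μ⁻¹ + γ) with hρ
  have hμ' : 0 < μ⁻¹ := inv_pos.2 hμ
  have hden : 0 < 20 * L + μ⁻¹ + γ := by positivity
  have hη : (0.05 / L)⁻¹ = 20 * L := by field_simp; norm_num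
  suffices hs : ∀ s ≤ S, ‖xbar s - z‖ ≤ ρ ^ s * ‖c - z‖ from hs S le_rfl
  intro s
  induction s with
  | zero => intro _; rw [h0, pow_zero, one_mul]
  | succ s ih =>
    intro hs
    obtain ⟨hy0, hstep, hxs⟩ := hrun s (by omega)
    have hrec : ∀ t < T, (20 * L + μ⁻¹ + γ) * ‖y (s + 1) (t + 1) - z‖ ≤
        21 * L * ‖y (s + 1) t - z‖ + 2 * L * ‖xbar s - z‖ := by
      intro t ht
      have h1 := norm_svrg_step_le (y := y (s + 1) t) (xbar := xbar s) hL hμ hγ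
        (by positivity : 0 < 0.05 / L) hg (hgi (i (s + 1) (t + 1))) hz
      rw [← svrg_step_eq hL hμ hγ (hstep t ht), hη] at h1
      linarith
    -- The first bound carries the induction from `t = 0`; the contraction holds only from `t = 1`
    -- on, which is where the averaging over the epoch begins. The factor is `23 = 20 + 1 + 2`, with
    -- `20 * L = η⁻¹`.
    have hy : ∀ t ≤ T, ‖y (s + 1) t - z‖ ≤ ‖xbar s - z‖ ∧
        (1 ≤ t → ‖y (s + 1) t - z‖ ≤ ρ * ‖xbar s - z‖) := by
      intro t
      induction t with
      | zero => intro _; rw [hy0]; exact ⟨le_rfl, fun h => absurd h (by norm_num)⟩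
      | succ t iht =>
        intro ht
        have h1 := hrec t (by omega)
        have h2 := (iht (by omega)).1
        have h3 : (20 * L + μ⁻¹ + γ) * ‖y (s + 1) (t + 1) - z‖ ≤ 23 * L * ‖xbar s - z‖ := by
          nlinarith
        have h4 : ‖y (s + 1) (t + 1) - z‖ ≤ ρ * ‖xbar s - z‖ := by
          rw [hρ, div_mul_eq_mul_div, le_div_iff₀ hden]
          linarith
        have h5 : ρ ≤ 1 := (div_le_one hden).2 (by linarith)
        exact ⟨h4.trans (mul_le_of_le_one_left (norm_nonneg _) h5), fun _ => h4⟩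
    have hT0 : (0 : ℝ) < T := by exact_mod_cast hT
    have h1 : xbar (s + 1) - z = (T : ℝ)⁻¹ • ∑ t ∈ Finset.Icc 1 T, (y (s + 1) t - z) := by
      rw [hxs, Finset.sum_sub_distrib, smul_sub, Finset.sum_const, Nat.card_Icc,
        Nat.add_sub_cancel, ← Nat.cast_smul_eq_nsmul ℝ, smul_smul, inv_mul_cancel₀ hT0.ne',
        one_smul]
    have h2 : ‖∑ t ∈ Finset.Icc 1 T, (y (s + 1) t - z)‖ ≤ T * (ρ * ‖xbar s - z‖) := by
      refine (norm_sum_le _ _).trans ?_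
      refine (Finset.sum_le_card_nsmul _ _ (ρ * ‖xbar s - z‖) fun t ht => ?_).trans_eq ?_
      · rw [Finset.mem_Icc] at ht
        exact (hy t ht.2).2 ht.1
      · rw [Nat.card_Icc, Nat.add_sub_cancel, nsmul_eq_mul]
    rw [h1, norm_smul, norm_inv, Real.norm_eq_abs, abs_of_pos hT0, inv_mul_le_iff₀ hT0]
    refine h2.trans (mul_le_mul_of_nonneg_left ?_ hT0.le)
    rw [pow_succ, mul_comm (ρ ^ s), mul_assoc]
    exact mul_le_mul_of_nonneg_left (ih (by omega)) (by positivity)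

/-- A call specifies its iterates only as minimizers; their uniqueness gives the closed form
`proxStep`, which is measurable in the data. -/
lemma measurable_of_svrgCall {Ω : Type*} {m : MeasurableSpace Ω} (hL : 0 < L) (hμ : 0 < μ)
    (hγ : 0 < γ) (hg : LSmooth L g) (hgi : ∀ i, LSmooth L (gi i)) (huH : Measurable uH)
    {c out : Ω → Vec d} {i : ℕ → ℕ → Ω → Fin n} (hc : Measurable c)
    (hi : ∀ s t, Measurable (i s t))
    (hcall : ∀ ω, SVRGCall gi g uH (quadReg μ) γ (0.05 / L) T S (c ω) (fun s t => i s t ω)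
      (out ω)) : Measurable out := by
  choose xbar y h0 hrun hout using hcall
  have hgim : Measurable fun q : Fin n × Vec d => gradient (gi q.1) q.2 :=
    measurable_from_prod_countable_right fun j => (hgi j).continuous_gradient.measurable
  have hgm := hg.continuous_gradient.measurable
  have hs : ∀ s ≤ S, Measurable fun ω => xbar ω s := by
    intro s
    induction s with
    | zero => intro _; simpa only [h0] using hc
    | succ s ih =>
      intro hs
      have hxs := ih (by omega)
      have hy : ∀ t ≤ T, Measurable fun ω => y ω (s + 1) t := by
        intro t
        induction t with
        | zero =>
          intro _
          simpa only [(hrun _ s (by omega)).1] using hxs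
        | succ t iht =>
          intro ht
          have hyt := iht (by omega)
          have heq : (fun ω => y ω (s + 1) (t + 1)) = fun ω => proxStep μ γ (0.05 / L) (c ω)
              (y ω (s + 1) t) (gradient (gi (i (s + 1) (t + 1) ω)) (y ω (s + 1) t) -
                gradient (gi (i (s + 1) (t + 1) ω)) (xbar ω s) +
                (gradient g (xbar ω s) - uH (c ω))) :=
            funext fun ω => svrg_step_eq hL hμ hγ ((hrun ω s (by omega)).2.1 t (by omega))
          rw [heq]
          exact measurable_proxStep hc hyt
            (((hgim.comp ((hi _ _).prodMk hyt)).sub (hgim.comp ((hi _ _).prodMk hxs))).add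
              ((hgm.comp hxs).sub (huH.comp hc)))
      have heq : (fun ω => xbar ω (s + 1)) =
          fun ω => (T : ℝ)⁻¹ • ∑ t ∈ Finset.Icc 1 T, y ω (s + 1) t :=
        funext fun ω => (hrun ω s (by omega)).2.2
      rw [heq]
      exact (Finset.measurable_fun_sum _ fun t ht =>
        hy t (Finset.mem_Icc.1 ht).2).const_smul (T : ℝ)⁻¹
  have : out = fun ω => xbar ω S := funext hout
  rw [this]
  exact hs S le_rfl

/-- From stage 2 on there is at least one epoch, and its contraction brings the optimization error
below half of the guaranteed decrease. The gap thus decreases along every path and never exceeds its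
initial value `Δ`. -/
theorem SVRGRun.nearlyCritical {r : Vec d → EReal} {x₁ : Vec d} {Δ : ℝ} {p J : Vec d → Vec d}
    {Ω : Type*} {mΩ : MeasurableSpace Ω} {P : Measure Ω} [IsProbabilityMeasure P]
    {α A ε : ℝ} {a K : ℕ} {T : ℕ → ℕ}
    (S : SmoothedDC g h r L (ε ^ a) γ x₁ Δ p J) (hgi : ∀ i, LSmooth L (gi i))
    (hε : ε ∈ Ioc (0 : ℝ) 1) (hα : 0 ≤ α) (hK : 1 / ε ^ (2 * (a + 1)) ≤ (K : ℝ)) (hA : 0 ≤ A)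
    (hpx : ∀ x, ‖x - p x‖ ^ 2 ≤ A * ε ^ 2 * (envGap g h r (ε ^ a) x₁ Δ x + 1))
    (hT : ∀ k, 1 ≤ T k) (hsmall : 3 * L ≤ (ε ^ a)⁻¹) (hsmall' : 1058 * L ^ 2 ≤ γ * (ε ^ a)⁻¹)
    {i : ℕ → ℕ → ℕ → Ω → Fin n} {x : ℕ → Ω → Vec d} {τ : Ω → ℕ}
    (hrun : SVRGRun P gi g h r x₁ L (ε ^ a) γ α T K p i x τ) :
    NearlyCritical P g h r p x τ (rateConst L γ α A Δ (Δ / 2) * ε) := by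
  have hL := S.L_pos
  have hγ := S.γ_pos
  have hμ := S.μ_pos
  have hμ' : 0 < (ε ^ a)⁻¹ := inv_pos.2 hμ
  have hΔ : 0 ≤ Δ := by simpa using S.gap x₁
  have hK0 : (0 : ℝ) < K := lt_of_lt_of_le (by have := hε.1; positivity) hK
  have hK1 : 1 ≤ K := by exact_mod_cast hK0
  obtain ⟨hx₁, hcall⟩ := hrun.run
  set F : Ω → (ℕ × ℕ × ℕ → Fin n) := fun ω j => i j.1 j.2.1 j.2.2 ω with hF
  have hFm : Measurable F := measurable_pi_lambda _ fun j => hrun.sample_measurable _ _ _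
  have him : ∀ k s t, Measurable[MeasurableSpace.comap F inferInstance] (i k s t) := fun k s t =>
    (measurable_pi_apply (k, s, t)).comp (comap_measurable F)
  have hx : ∀ k, 1 ≤ k → k ≤ K + 1 →
      Measurable[MeasurableSpace.comap F inferInstance] (x k) := by
    intro k hk
    induction k, hk using Nat.le_induction with
    | base =>
      intro _
      have : x 1 = fun _ => x₁ := funext hx₁
      rw [this]
      exact measurable_const
    | succ k hk ih =>
      intro hkK
      refine measurable_of_svrgCall hL hμ hγ S.g_smooth hgi
        (uH := fun x => gradient h x + (ε ^ a)⁻¹ • p x)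
        (S.h_smooth.continuous_gradient.measurable.add (S.p_measurable.const_smul (ε ^ a)⁻¹))
        (ih (by omega)) (him k) (hcall k (by simp; omega))
  have hdesc : ∀ k ∈ Finset.Icc 1 K, k ≠ 1 → ∀ ω, envGap g h r (ε ^ a) x₁ Δ (x (k + 1) ω) +
      γ / 4 * ‖x k ω - stagePoint h (ε ^ a) γ p J (x k ω)‖ ^ 2 ≤
      envGap g h r (ε ^ a) x₁ Δ (x k ω) := by
    intro k hk hk1 ω
    have hz := S.stagePoint_spec (x k ω)
    have h1 := (hcall k hk ω).norm_sub_le (z := stagePoint h (ε ^ a) γ p J (x k ω))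
      (uH := fun x => gradient h x + (ε ^ a)⁻¹ • p x) hL hμ hγ
      S.g_smooth hgi (hT k) hz hsmall
    have h2 := S.envGap_descent (x k ω) (x (k + 1) ω)
    have h3 := stageObj_upper S.g_smooth hz (x (k + 1) ω)
    set z := stagePoint h (ε ^ a) γ p J (x k ω)
    set ρ := 23 * L / (20 * L + (ε ^ a)⁻¹ + γ) with hρ
    have hden : 0 < 20 * L + (ε ^ a)⁻¹ + γ := by positivity
    have hρ1 : ρ ≤ 1 := (div_le_one hden).2 (by linarith)
    have hρ0 : 0 ≤ ρ := by positivity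
    have hS : ⌈Real.logb 2 k⌉₊ ≠ 0 := by
      have : 1 < k := by rw [Finset.mem_Icc] at hk; omega
      have h4 : 0 < Real.logb 2 k := Real.logb_pos one_lt_two (by exact_mod_cast this)
      exact (Nat.ceil_pos.2 h4).ne'
    have h5 : ‖x (k + 1) ω - z‖ ≤ ρ * ‖x k ω - z‖ :=
      h1.trans (mul_le_mul_of_nonneg_right (pow_le_of_le_one hρ0 hρ1 hS) (norm_nonneg _))
    have h6 : ‖x (k + 1) ω - z‖ ^ 2 ≤ ρ ^ 2 * ‖x k ω - z‖ ^ 2 := by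
      rw [← mul_pow]
      exact pow_le_pow_left₀ (norm_nonneg _) h5 2
    -- The left side is at most `23 ^ 2 * L ^ 2 / (20 * L + 1/μ + γ)`, and `1058 = 2 * 23 ^ 2`.
    have h7 : (L + ((ε ^ a)⁻¹ + γ)) * ρ ^ 2 ≤ γ / 2 := by
      have e1 : (L + ((ε ^ a)⁻¹ + γ)) * ρ ^ 2 ≤ (20 * L + (ε ^ a)⁻¹ + γ) * ρ ^ 2 :=
        mul_le_mul_of_nonneg_right (by linarith) (sq_nonneg _)
      have e2 : (20 * L + (ε ^ a)⁻¹ + γ) * ρ ^ 2 = 529 * L ^ 2 / (20 * L + (ε ^ a)⁻¹ + γ) := by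
        rw [hρ]; field_simp; norm_num
      refine e1.trans (e2.trans_le ?_)
      rw [div_le_iff₀ hden]
      nlinarith [mul_pos hγ hL, mul_pos hγ hγ]
    have h8 : (L + ((ε ^ a)⁻¹ + γ)) / 2 * ‖x (k + 1) ω - z‖ ^ 2 ≤
        γ / 4 * ‖x k ω - z‖ ^ 2 := by
      have e1 := mul_le_mul_of_nonneg_left h6
        (by positivity : 0 ≤ (L + ((ε ^ a)⁻¹ + γ)) / 2)
      have e2 := mul_le_mul_of_nonneg_right h7 (sq_nonneg ‖x k ω - z‖)
      linarith
    linarith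
  -- Stage 1 has `⌈log₂ 1⌉ = 0` epochs and makes no progress.
  have hone : ∀ ω, x 2 ω = x 1 ω := by
    intro ω
    obtain ⟨xbar, y, h0, -, hout⟩ := hcall 1 (by simp [hK1]) ω
    rw [hout, Nat.cast_one, Real.logb_one, Nat.ceil_zero, h0]
  have hbound : ∀ k, 1 ≤ k → k ≤ K + 1 → ∀ ω, envGap g h r (ε ^ a) x₁ Δ (x k ω) ≤ Δ := by
    intro k hk
    induction k, hk using Nat.le_induction with
    | base =>
      intro _ ω
      rw [hx₁, SmoothedDC.envGap_self]
    | succ k hk ih =>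
      intro hkK ω
      have h1 := ih (by omega) ω
      by_cases hk1 : k = 1
      · subst hk1
        rwa [hone ω]
      · have h2 := hdesc k (by simp; omega) hk1 ω
        have h3 : 0 ≤ γ / 4 * ‖x k ω - stagePoint h (ε ^ a) γ p J (x k ω)‖ ^ 2 := by positivity
        linarith
  have hint : ∀ k, 1 ≤ k → k ≤ K + 1 →
      Integrable (fun ω => envGap g h r (ε ^ a) x₁ Δ (x k ω)) P := by
    intro k hk hkK
    refine (integrable_const Δ).mono'
      (S.measurable_envGap.comp ((hx k hk hkK).mono hFm.comap_le le_rfl)).aestronglyMeasurable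
      (Filter.Eventually.of_forall fun ω => ?_)
    rw [Real.norm_eq_abs, abs_of_nonneg (S.envGap_nonneg _)]
    exact hbound k hk hkK ω
  have hind : Indep (MeasurableSpace.comap τ inferInstance)
      (MeasurableSpace.comap F inferInstance) P := (IndepFun_iff_Indep _ _ _).1 hrun.index_indep
  -- The idle first stage needs an error term: there `γ/4 * ‖x₁ - z‖ ^ 2` is at most half the
  -- initial gap `Δ`.
  refine S.nearlyCritical (θ := fun k => if k = 1 then Δ / 2 else 0) hε hα hK hA hΔ
    (by positivity) hpx hrun.index_law hFm.comap_le hind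
    (fun k hk => hx k (Finset.mem_Icc.1 hk).1 (by have := (Finset.mem_Icc.1 hk).2; omega))
    (fun k hk => hint k (Finset.mem_Icc.1 hk).1 (by have := (Finset.mem_Icc.1 hk).2; omega))
    (fun k hk => ?_) (fun k hk => ?_) ?_
  · rw [Finset.mem_Icc] at hk
    have := integral_mono (hint k hk.1 (by omega)) (integrable_const Δ)
      (hbound k hk.1 (by omega))
    simpa using this
  · have hk' := Finset.mem_Icc.1 hk
    have hi1 := hint k hk'.1 (by omega)
    have hi2 := hint (k + 1) (by omega) (by omega)
    have hZ := S.integrable_sq_norm_sub_stagePoint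
      ((hx k hk'.1 (by omega)).mono hFm.comap_le le_rfl) hi1
    by_cases hk1 : k = 1
    · subst hk1
      have h1 : ∫ ω, γ / 4 * ‖x 1 ω - stagePoint h (ε ^ a) γ p J (x 1 ω)‖ ^ 2 ∂P ≤
          ∫ ω, Δ / 2 ∂P := by
        refine integral_mono (hZ.const_mul _) (integrable_const _) fun ω => ?_
        have h2 := S.sq_norm_sub_stagePoint_le (x 1 ω)
        rw [hx₁, SmoothedDC.envGap_self] at h2
        simp only [hx₁]
        linarith
      rw [integral_const_mul] at h1
      simp only [hone, sub_self, if_true, zero_add]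
      simpa using h1
    · simp only [hk1, if_false, add_zero]
      rw [← integral_sub hi1 hi2, ← integral_const_mul]
      refine integral_mono (hZ.const_mul _) (hi1.sub hi2) fun ω => ?_
      have := hdesc k hk hk1 ω
      simp only
      linarith
  · have h1 : (1 : ℝ) ≤ (K : ℝ) ^ α := Real.one_le_rpow (by exact_mod_cast hK1) hα
    simp only [mul_ite, mul_zero]
    rw [Finset.sum_ite_eq' (Finset.Icc 1 K) 1, if_pos (by simp [hK1])]
    simp only [Nat.cast_one, Real.one_rpow]
    exact mul_le_mul_of_nonneg_right h1 (by positivity)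

end SVRG

/-! ### Second moments of random vectors. -/

section SecondMoments

variable {α : Type*} [MeasurableSpace α] {ν : Measure α} {d : ℕ}

lemma enorm_sq_eq_ofReal (x : Vec d) : ‖x‖ₑ ^ 2 = ENNReal.ofReal (‖x‖ ^ 2) := by
  rw [← ofReal_norm, ENNReal.ofReal_pow (norm_nonneg _)]

lemma integrable_sq_norm_of_lintegral {f : α → Vec d} (hf : AEStronglyMeasurable f ν)
    (h : ∫⁻ a, ‖f a‖ₑ ^ 2 ∂ν ≠ ⊤) : Integrable (fun a => ‖f a‖ ^ 2) ν := by
  refine ⟨hf.norm.pow 2, ?_⟩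
  rw [hasFiniteIntegral_iff_ofReal (Filter.Eventually.of_forall fun a => sq_nonneg _)]
  simp only [enorm_sq_eq_ofReal] at h
  exact h.lt_top

lemma lintegral_enorm_sq {f : α → Vec d} (hf : Integrable (fun a => ‖f a‖ ^ 2) ν) :
    ∫⁻ a, ‖f a‖ₑ ^ 2 ∂ν = ENNReal.ofReal (∫ a, ‖f a‖ ^ 2 ∂ν) := by
  simp only [enorm_sq_eq_ofReal]
  rw [ofReal_integral_eq_lintegral_ofReal hf (Filter.Eventually.of_forall fun a => sq_nonneg _)]

lemma integrable_inner_of_sq {f g : α → Vec d} (hfm : AEStronglyMeasurable f ν)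
    (hgm : AEStronglyMeasurable g ν) (hf : Integrable (fun a => ‖f a‖ ^ 2) ν)
    (hg : Integrable (fun a => ‖g a‖ ^ 2) ν) : Integrable (fun a => inner ℝ (f a) (g a)) ν := by
  refine (hf.add hg).mono' (hfm.inner hgm) (Filter.Eventually.of_forall fun a => ?_)
  have h1 := norm_inner_le_norm (𝕜 := ℝ) (f a) (g a)
  simp only [Pi.add_apply]
  nlinarith [sq_nonneg (‖f a‖ - ‖g a‖), sq_nonneg ‖f a‖, sq_nonneg ‖g a‖]

/-- Among all shifts of a centered random vector, the vector itself has the least second moment. -/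
lemma lintegral_enorm_sq_le_sub [IsProbabilityMeasure ν] {f : α → Vec d} (hf : Integrable f ν)
    (h0 : ∫ a, f a ∂ν = 0) (b : Vec d) :
    ∫⁻ a, ‖f a‖ₑ ^ 2 ∂ν ≤ ∫⁻ a, ‖f a - b‖ₑ ^ 2 ∂ν := by
  rcases eq_or_ne (∫⁻ a, ‖f a - b‖ₑ ^ 2 ∂ν) ⊤ with h | h
  · rw [h]; exact le_top
  have h1 : Integrable (fun a => ‖f a - b‖ ^ 2) ν :=
    integrable_sq_norm_of_lintegral (hf.1.sub aestronglyMeasurable_const) h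
  have heq : (fun a => ‖f a‖ ^ 2) = fun a => ‖f a - b‖ ^ 2 + (2 * inner ℝ (f a) b - ‖b‖ ^ 2) := by
    funext a
    rw [norm_sub_sq_real]
    ring
  have hin : Integrable (fun a => 2 * inner ℝ (f a) b - ‖b‖ ^ 2) ν :=
    ((hf.inner_const b).const_mul 2).sub (integrable_const _)
  have h2 : Integrable (fun a => ‖f a‖ ^ 2) ν := by
    rw [heq]; exact h1.add hin
  rw [lintegral_enorm_sq h2, lintegral_enorm_sq h1]
  refine ENNReal.ofReal_le_ofReal ?_
  have h3 : ∫ a, inner ℝ (f a) b ∂ν = 0 := by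
    simp only [real_inner_comm b]
    rw [integral_inner hf, h0, inner_zero_right]
  rw [heq, integral_add h1 hin, integral_sub ((hf.inner_const b).const_mul 2) (integrable_const _),
    integral_const_mul, h3]
  simp only [integral_const, probReal_univ, one_smul, mul_zero, zero_sub]
  linarith [sq_nonneg ‖b‖]

end SecondMoments

/-! ### The gradient noise of SPG. -/

section Noise

variable {d : ℕ} {Ξ Z : Type*} [MeasurableSpace Ξ] [MeasurableSpace Z]

/-- The error of the stochastic gradient `vg(y; ξ) - vh(c; ς)` of `g - ⟪∇h(c), ·⟫` at `y`. -/
noncomputable def gradNoise (g h : Vec d → ℝ) (vg : Vec d → Ξ → Vec d) (vh : Vec d → Z → Vec d)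
    (a : Vec d × Vec d) (q : Ξ × Z) : Vec d :=
  (vg a.1 q.1 - vh a.2 q.2) - (gradient g a.1 - gradient h a.2)

variable {νξ : Measure Ξ} {νς : Measure Z} [IsProbabilityMeasure νξ] [IsProbabilityMeasure νς]
  {g h : Vec d → ℝ} {vg : Vec d → Ξ → Vec d} {vh : Vec d → Z → Vec d} {G L : ℝ}

lemma measurable_gradNoise (hg : LSmooth L g) (hh : LSmooth L h)
    (hvg : Measurable (Function.uncurry vg)) (hvh : Measurable (Function.uncurry vh)) :
    Measurable fun w : (Vec d × Vec d) × (Ξ × Z) => gradNoise g h vg vh w.1 w.2 := by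
  have h1 : Measurable fun w : (Vec d × Vec d) × (Ξ × Z) => vg w.1.1 w.2.1 :=
    hvg.comp (f := fun w : (Vec d × Vec d) × (Ξ × Z) => (w.1.1, w.2.1)) (by fun_prop)
  have h2 : Measurable fun w : (Vec d × Vec d) × (Ξ × Z) => vh w.1.2 w.2.2 :=
    hvh.comp (f := fun w : (Vec d × Vec d) × (Ξ × Z) => (w.1.2, w.2.2)) (by fun_prop)
  have h3 := hg.continuous_gradient.measurable
  have h4 := hh.continuous_gradient.measurable
  unfold gradNoise
  fun_prop

lemma gradNoise_integral (hvg : UnbiasedGradient νξ vg g) (hvh : UnbiasedGradient νς vh h)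
    (a : Vec d × Vec d) : Integrable (gradNoise g h vg vh a) (νξ.prod νς) ∧
      ∫ q, gradNoise g h vg vh a q ∂(νξ.prod νς) = 0 := by
  have h1 := (hvg.2 a.1).1.comp_fst νς
  have h2 := (hvh.2 a.2).1.comp_snd νξ
  have h12 : Integrable (fun q => vg a.1 q.1 - vh a.2 q.2) (νξ.prod νς) := h1.sub h2
  refine ⟨h12.sub (integrable_const _), ?_⟩
  unfold gradNoise
  rw [integral_sub h12 (integrable_const _), integral_sub h1 h2, integral_fun_fst,
    integral_fun_snd, (hvg.2 a.1).2, (hvh.2 a.2).2]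
  simp

/-- The hypothesis bounds the difference of the two stochastic gradients at a common point, whereas
SPG evaluates them at different points, so separate bounds are needed. With one sample fixed, the
difference is a shift of the other centered gradient, and a shift cannot lower its second moment. -/
lemma lintegral_vg_le (hvg : UnbiasedGradient νξ vg g) (hvh : UnbiasedGradient νς vh h)
    (hvar : VarianceBound νξ νς vg vh G) (x : Vec d) :
    ∫⁻ ξ, ‖vg x ξ - gradient g x‖ₑ ^ 2 ∂νξ ≤ ENNReal.ofReal (G ^ 2) ∧
      ∫⁻ ς, ‖vh x ς - gradient h x‖ₑ ^ 2 ∂νς ≤ ENNReal.ofReal (G ^ 2) := by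
  have h1 := (hvg.2 x).1
  have h2 := (hvh.2 x).1
  have hv := hvar x
  rw [integral_sub (h1.comp_fst νς) (h2.comp_snd νξ), integral_fun_fst, integral_fun_snd,
    (hvg.2 x).2, (hvh.2 x).2] at hv
  simp only [probReal_univ, one_smul] at hv
  have hm1 : Measurable (vg x) := hvg.1.comp measurable_prodMk_left
  have hm2 : Measurable (vh x) := hvh.1.comp measurable_prodMk_left
  have hm : Measurable fun q : Ξ × Z =>
      ‖vg x q.1 - vh x q.2 - (gradient g x - gradient h x)‖ₑ ^ 2 := by fun_prop
  have hA0 : ∫ ξ, (vg x ξ - gradient g x) ∂νξ = 0 := by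
    rw [integral_sub h1 (integrable_const _), (hvg.2 x).2]; simp
  have hB0 : ∫ ς, (vh x ς - gradient h x) ∂νς = 0 := by
    rw [integral_sub h2 (integrable_const _), (hvh.2 x).2]; simp
  constructor
  · rw [lintegral_prod_symm _ hm.aemeasurable] at hv
    refine le_trans ?_ hv
    calc ∫⁻ ξ, ‖vg x ξ - gradient g x‖ₑ ^ 2 ∂νξ
        = ∫⁻ _ : Z, ∫⁻ ξ, ‖vg x ξ - gradient g x‖ₑ ^ 2 ∂νξ ∂νς := by simp
      _ ≤ _ := lintegral_mono fun ς => by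
        refine (lintegral_enorm_sq_le_sub (h1.sub (integrable_const _)) hA0
          (vh x ς - gradient h x)).trans_eq (lintegral_congr fun ξ => ?_)
        congr 2
        simp only [Pi.sub_apply]
        abel
  · rw [lintegral_prod _ hm.aemeasurable] at hv
    refine le_trans ?_ hv
    calc ∫⁻ ς, ‖vh x ς - gradient h x‖ₑ ^ 2 ∂νς
        = ∫⁻ _ : Ξ, ∫⁻ ς, ‖vh x ς - gradient h x‖ₑ ^ 2 ∂νς ∂νξ := by simp
      _ ≤ _ := lintegral_mono fun ξ => by
        refine (lintegral_enorm_sq_le_sub (h2.sub (integrable_const _)) hB0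
          (vg x ξ - gradient g x)).trans_eq (lintegral_congr fun ς => ?_)
        rw [enorm_sq_eq_ofReal, enorm_sq_eq_ofReal, norm_sub_rev]
        congr 3
        simp only [Pi.sub_apply]
        abel

lemma lintegral_gradNoise_le (hvg : UnbiasedGradient νξ vg g) (hvh : UnbiasedGradient νς vh h)
    (hvar : VarianceBound νξ νς vg vh G) (a : Vec d × Vec d) :
    ∫⁻ q, ‖gradNoise g h vg vh a q‖ₑ ^ 2 ∂(νξ.prod νς) ≤ ENNReal.ofReal (4 * G ^ 2) := by
  have hm1 : Measurable (vg a.1) := hvg.1.comp measurable_prodMk_left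
  have hm2 : Measurable (vh a.2) := hvh.1.comp measurable_prodMk_left
  have hA : Measurable fun ξ => ‖vg a.1 ξ - gradient g a.1‖ₑ ^ 2 := by fun_prop
  have hB : Measurable fun ς => ‖vh a.2 ς - gradient h a.2‖ₑ ^ 2 := by fun_prop
  calc ∫⁻ q, ‖gradNoise g h vg vh a q‖ₑ ^ 2 ∂(νξ.prod νς)
      ≤ ∫⁻ q, (ENNReal.ofReal 2 * ‖vg a.1 q.1 - gradient g a.1‖ₑ ^ 2 +
          ENNReal.ofReal 2 * ‖vh a.2 q.2 - gradient h a.2‖ₑ ^ 2) ∂(νξ.prod νς) := by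
        refine lintegral_mono fun q => ?_
        simp only [enorm_sq_eq_ofReal]
        rw [← ENNReal.ofReal_mul (by norm_num),
          ← ENNReal.ofReal_mul (by norm_num), ← ENNReal.ofReal_add (by positivity) (by positivity)]
        refine ENNReal.ofReal_le_ofReal ?_
        have h1 : gradNoise g h vg vh a q = (vg a.1 q.1 - gradient g a.1) -
            (vh a.2 q.2 - gradient h a.2) := by unfold gradNoise; abel
        rw [h1]
        have h2 := norm_sub_le (vg a.1 q.1 - gradient g a.1) (vh a.2 q.2 - gradient h a.2)
        have h3 := pow_le_pow_left₀ (norm_nonneg _) h2 2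
        nlinarith [sq_nonneg (‖vg a.1 q.1 - gradient g a.1‖ - ‖vh a.2 q.2 - gradient h a.2‖)]
    _ = ENNReal.ofReal 2 * ∫⁻ ξ, ‖vg a.1 ξ - gradient g a.1‖ₑ ^ 2 ∂νξ +
          ENNReal.ofReal 2 * ∫⁻ ς, ‖vh a.2 ς - gradient h a.2‖ₑ ^ 2 ∂νς := by
        rw [lintegral_add_left (by fun_prop), lintegral_const_mul _ (by fun_prop),
          lintegral_const_mul _ (by fun_prop), lintegral_prod _ (by fun_prop),
          lintegral_prod _ (by fun_prop)]
        simp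
    _ ≤ ENNReal.ofReal 2 * ENNReal.ofReal (G ^ 2) + ENNReal.ofReal 2 * ENNReal.ofReal (G ^ 2) := by
        gcongr
        · exact (lintegral_vg_le hvg hvh hvar a.1).1
        · exact (lintegral_vg_le hvg hvh hvar a.2).2
    _ = ENNReal.ofReal (4 * G ^ 2) := by
        rw [← ENNReal.ofReal_mul (by norm_num), ← ENNReal.ofReal_add (by positivity) (by positivity)]
        congr 1
        ring

end Noise

/-! ### Functions of the past and of one fresh sample. -/

section FreshSample

variable {Ω α β : Type*} [MeasurableSpace Ω] [MeasurableSpace α] [MeasurableSpace β]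
  {P : Measure Ω} [IsProbabilityMeasure P] {ν : Measure β} [IsProbabilityMeasure ν] {d : ℕ}
  {U : Ω → α} {q : Ω → β} {N : α → β → Vec d}

lemma lintegral_enorm_sq_fresh_le (hU : Measurable U) (hq : Measurable q)
    (hind : IndepFun U q P) (hlaw : P.map q = ν)
    (hN : Measurable fun w : α × β => N w.1 w.2) {b : ℝ≥0∞}
    (hb : ∀ u, ∫⁻ z, ‖N u z‖ₑ ^ 2 ∂ν ≤ b) : ∫⁻ ω, ‖N (U ω) (q ω)‖ₑ ^ 2 ∂P ≤ b := by
  have : IsProbabilityMeasure (P.map U) := Measure.isProbabilityMeasure_map hU.aemeasurable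
  have h1 := (indepFun_iff_map_prod_eq_prod_map_map hU.aemeasurable hq.aemeasurable).1 hind
  rw [hlaw] at h1
  have hm : Measurable fun w : α × β => ‖N w.1 w.2‖ₑ ^ 2 := by fun_prop
  have h2 := lintegral_map (μ := P) hm (hU.prodMk hq)
  rw [h1, lintegral_prod _ hm.aemeasurable] at h2
  rw [← h2]
  calc _ ≤ ∫⁻ _ : α, b ∂(P.map U) := lintegral_mono hb
    _ = b := by simp

/-- By independence the joint law is a product, and Fubini allows the integral over the sample to be
taken first, with `W` fixed by the past. -/
lemma integral_inner_fresh_eq_zero (hU : Measurable U) (hq : Measurable q)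
    (hind : IndepFun U q P) (hlaw : P.map q = ν)
    (hN : Measurable fun w : α × β => N w.1 w.2) (hN0 : ∀ u, Integrable (N u) ν ∧
      ∫ z, N u z ∂ν = 0) {W : α → Vec d} (hW : Measurable W)
    (hi : Integrable (fun ω => inner ℝ (N (U ω) (q ω)) (W (U ω))) P) :
    ∫ ω, inner ℝ (N (U ω) (q ω)) (W (U ω)) ∂P = 0 := by
  have : IsProbabilityMeasure (P.map U) := Measure.isProbabilityMeasure_map hU.aemeasurable
  have h1 := (indepFun_iff_map_prod_eq_prod_map_map hU.aemeasurable hq.aemeasurable).1 hind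
  rw [hlaw] at h1
  have hm : Measurable fun w : α × β => (inner ℝ (N w.1 w.2) (W w.1) : ℝ) :=
    hN.inner (hW.comp measurable_fst)
  have h2 := integral_map (μ := P) (hU.prodMk hq).aemeasurable hm.aestronglyMeasurable
  have h3 := (integrable_map_measure (μ := P) hm.aestronglyMeasurable
    (hU.prodMk hq).aemeasurable).2 hi
  rw [h1] at h2 h3
  rw [integral_prod _ h3] at h2
  rw [← h2]
  refine integral_eq_zero_of_ae (Filter.Eventually.of_forall fun u => ?_)
  simp only [real_inner_comm (W u)]
  rw [integral_inner (hN0 u).1, (hN0 u).2, inner_zero_right]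
  rfl

end FreshSample

/-! ### SPG: inequalities along a fixed path. -/

section Pathwise

variable {d : ℕ} {g : Vec d → ℝ} {L μ γ η : ℝ} {u c y z N : Vec d}

/-- One stochastic proximal gradient step; `N` is the error of the stochastic gradient. -/
lemma spg_step_le (hg_conv : ConvexOn ℝ univ g) (hg : LSmooth L g) (hμ : 0 < μ)
    (hγ : 0 < γ) (hη : 0 < η) (hηL : 2 * L ≤ η⁻¹) :
    stageObj g μ γ u c (proxStep μ γ η c y (gradient g y - u + N)) - stageObj g μ γ u c z ≤
      η * ‖N‖ ^ 2 - inner ℝ N (y - z) + η⁻¹ / 2 * ‖y - z‖ ^ 2 -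
        (η⁻¹ / 2 + γ / 2) * ‖proxStep μ γ η c y (gradient g y - u + N) - z‖ ^ 2 := by
  have hpos : 0 < η⁻¹ + μ⁻¹ + γ := by positivity
  set y' := proxStep μ γ η c y (gradient g y - u + N) with hy'
  have h1 : (η⁻¹ + μ⁻¹ + γ) • y' = η⁻¹ • y + γ • c - (gradient g y - u + N) := by
    rw [hy', proxStep, smul_smul, mul_inv_cancel₀ hpos.ne', one_smul]
  have h2 : (μ⁻¹ + γ) • y' - (u + γ • c) = η⁻¹ • (y - y') - gradient g y - N := by
    have : (μ⁻¹ + γ) • y' = (η⁻¹ + μ⁻¹ + γ) • y' - η⁻¹ • y' := by module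
    rw [this, h1]
    module
  have h3 := quad_expand (μ := μ) (γ := γ) (u := u) (c := c) z y'
  rw [h2] at h3
  have h4 := gradient_le_of_convexOn hg_conv hg.1 y z
  have h5 := hg.le_quadratic y y'
  have h6 : 0 ≤ μ⁻¹ / 2 * ‖z - y'‖ ^ 2 := by positivity
  -- Smoothness costs `L/2`, at most `η⁻¹/4`, and Young's inequality costs another `η⁻¹/4`; together
  -- they use up the term `η⁻¹/2 * ‖y' - y‖ ^ 2` of the step.
  have h7 : inner ℝ N (y - y') ≤ η * ‖N‖ ^ 2 + η⁻¹ / 4 * ‖y' - y‖ ^ 2 := by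
    have e1 := real_inner_le_norm N (y - y')
    rw [norm_sub_rev y y'] at e1
    have e2 : η * ‖N‖ ^ 2 + η⁻¹ / 4 * ‖y' - y‖ ^ 2 - ‖N‖ * ‖y' - y‖ =
      η * (‖N‖ - η⁻¹ / 2 * ‖y' - y‖) ^ 2 := by field_simp; ring
    have e3 : 0 ≤ η * (‖N‖ - η⁻¹ / 2 * ‖y' - y‖) ^ 2 := by positivity
    linarith
  have h8 : 2 * L * ‖y' - y‖ ^ 2 ≤ η⁻¹ * ‖y' - y‖ ^ 2 :=
    mul_le_mul_of_nonneg_right hηL (sq_nonneg _)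
  have h9 : inner ℝ (y - y') (z - y') = (‖y - y'‖ ^ 2 + ‖z - y'‖ ^ 2 - ‖y - z‖ ^ 2) / 2 := by
    have : y - z = (y - y') - (z - y') := by abel
    rw [this, norm_sub_sq_real (y - y')]
    ring
  have h10 : inner ℝ (η⁻¹ • (y - y') - gradient g y - N) (z - y') =
      η⁻¹ * ((‖y' - y‖ ^ 2 + ‖z - y'‖ ^ 2 - ‖y - z‖ ^ 2) / 2) -
      (inner ℝ (gradient g y) (z - y) - inner ℝ (gradient g y) (y' - y)) +
      (inner ℝ N (y - z) - inner ℝ N (y - y')) := by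
    rw [inner_sub_left, inner_sub_left, inner_smul_left, h9, norm_sub_rev y y']
    simp only [inner_sub_right, conj_trivial]
    ring
  rw [h10] at h3
  rw [norm_sub_rev y' z]
  simp only [stageObj] at *
  linarith

/-- Jensen's inequality, from the tangent of the convex majorant at the average: the weighted
deviations from the average sum to zero. -/
lemma stageObj_weighted_average_le (hg_conv : ConvexOn ℝ univ g) (hg : LSmooth L g) (hμ : 0 < μ)
    (hγ : 0 < γ) {s : Finset ℕ} {w : ℕ → ℝ} (hw : ∀ t ∈ s, 0 ≤ w t) (hW : 0 < ∑ t ∈ s, w t)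
    (y : ℕ → Vec d) (b : ℝ) :
    (∑ t ∈ s, w t) * (stageObj g μ γ u c ((∑ t ∈ s, w t)⁻¹ • ∑ t ∈ s, w t • y t) - b) ≤
      ∑ t ∈ s, w t * (stageObj g μ γ u c (y t) - b) := by
  set W := ∑ t ∈ s, w t with hWdef
  set o := W⁻¹ • ∑ t ∈ s, w t • y t with ho
  set ξ := gradient g o + ((μ⁻¹ + γ) • o - (u + γ • c)) with hξ
  have h1 : ∀ t, stageObj g μ γ u c o + inner ℝ ξ (y t - o) ≤ stageObj g μ γ u c (y t) := by
    intro t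
    have e1 := gradient_le_of_convexOn hg_conv hg.1 o (y t)
    have e2 := quad_expand (μ := μ) (γ := γ) (u := u) (c := c) (y t) o
    have e3 : 0 ≤ (μ⁻¹ + γ) / 2 * ‖y t - o‖ ^ 2 := by positivity
    rw [hξ, inner_add_left]
    simp only [stageObj]
    linarith
  have h2 : ∑ t ∈ s, w t * inner ℝ ξ (y t - o) = 0 := by
    have e1 : ∑ t ∈ s, w t • (y t - o) = 0 := by
      simp only [smul_sub, Finset.sum_sub_distrib]
      rw [← Finset.sum_smul, ← hWdef, ho, smul_smul, mul_inv_cancel₀ hW.ne', one_smul, sub_self]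
    rw [← inner_zero_right ξ, ← e1, inner_sum]
    simp only [inner_smul_right]
  have h3 : ∑ t ∈ s, w t * (stageObj g μ γ u c o - b + inner ℝ ξ (y t - o)) ≤
      ∑ t ∈ s, w t * (stageObj g μ γ u c (y t) - b) :=
    Finset.sum_le_sum fun t ht => mul_le_mul_of_nonneg_left (by linarith [h1 t]) (hw t ht)
  simp only [mul_add, Finset.sum_add_distrib] at h3
  rw [h2, add_zero, ← Finset.sum_mul] at h3
  exact h3

/-- The step bound is multiplied by `t + 1`. With `η_t⁻¹ = γ(t + 1)/3` the distances have
coefficients `γ/6 * (t + 1)²` before and `γ/6 * (t + 1)(t + 4)` after the step; the latter is at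
least `γ/6 * (t + 2)²`, so the sum telescopes. The start `t = 1` contributes `2γ/3`, and `3 * L ≤ γ`
gives `2 * L ≤ η_t⁻¹` from there on. -/
lemma spg_sum_le (hg_conv : ConvexOn ℝ univ g) (hg : LSmooth L g) (hμ : 0 < μ)
    (hL : 0 < L) (hγL : 3 * L ≤ γ) {T : ℕ} {y N : ℕ → Vec d} (hy1 : y 1 = c)
    (hstep : ∀ t ∈ Finset.Icc 1 T, y (t + 1) =
      proxStep μ γ (3 / (γ * (t + 1))) c (y t) (gradient g (y t) - u + N t)) :
    ∑ t ∈ Finset.Icc 1 T, ((t : ℝ) + 1) * (stageObj g μ γ u c (y (t + 1)) - stageObj g μ γ u c z)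
      + γ / 6 * ((T : ℝ) + 2) ^ 2 * ‖y (T + 1) - z‖ ^ 2 ≤
      ∑ t ∈ Finset.Icc 1 T, (3 / γ * ‖N t‖ ^ 2 - ((t : ℝ) + 1) * inner ℝ (N t) (y t - z)) +
        2 * γ / 3 * ‖c - z‖ ^ 2 := by
  have hγ : 0 < γ := by linarith
  induction T with
  | zero =>
    simp only [hy1, zero_add, Nat.cast_zero, Finset.Icc_eq_empty_of_lt zero_lt_one,
      Finset.sum_empty]
    linarith
  | succ n ih =>
    have h1 := ih fun t ht => hstep t (Finset.Icc_subset_Icc_right (by omega) ht)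
    rw [Finset.sum_Icc_succ_top (by omega), Finset.sum_Icc_succ_top (by omega)]
    have hs := hstep (n + 1) (by simp)
    set t : ℝ := ((n + 1 : ℕ) : ℝ) with ht
    have ht0 : 0 < t + 1 := by positivity
    have ht1 : 1 ≤ t := by rw [ht]; push_cast; linarith [n.cast_nonneg (α := ℝ)]
    have hη : (3 / (γ * (t + 1)))⁻¹ = γ * (t + 1) / 3 := by rw [inv_div]
    have h2 := spg_step_le (u := u) (c := c) (y := y (n + 1)) (z := z) (N := N (n + 1))
      (η := 3 / (γ * (t + 1))) hg_conv hg hμ hγ (by positivity) (by rw [hη]; nlinarith)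
    rw [← hs, hη] at h2
    have h3 := mul_le_mul_of_nonneg_left h2 ht0.le
    have h4 : (t + 1) * (3 / (γ * (t + 1)) * ‖N (n + 1)‖ ^ 2 - inner ℝ (N (n + 1)) (y (n + 1) - z)
        + γ * (t + 1) / 3 / 2 * ‖y (n + 1) - z‖ ^ 2 -
        (γ * (t + 1) / 3 / 2 + γ / 2) * ‖y (n + 1 + 1) - z‖ ^ 2) =
        3 / γ * ‖N (n + 1)‖ ^ 2 - (t + 1) * inner ℝ (N (n + 1)) (y (n + 1) - z) +
        γ / 6 * (t + 1) ^ 2 * ‖y (n + 1) - z‖ ^ 2 -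
        γ / 6 * ((t + 1) * (t + 4)) * ‖y (n + 1 + 1) - z‖ ^ 2 := by
      field_simp
      ring
    rw [h4] at h3
    have h5 : γ / 6 * (t + 2) ^ 2 * ‖y (n + 1 + 1) - z‖ ^ 2 ≤
        γ / 6 * ((t + 1) * (t + 4)) * ‖y (n + 1 + 1) - z‖ ^ 2 := by
      gcongr
      nlinarith
    have h6 : (n : ℝ) + 2 = t + 1 := by rw [ht]; push_cast; ring
    rw [h6] at h1
    linarith

lemma sum_Icc_two (T : ℕ) : ∑ t ∈ Finset.Icc 2 (T + 1), (t : ℝ) = T * (T + 3) / 2 := by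
  induction T with
  | zero => simp
  | succ n ih =>
    rw [Finset.sum_Icc_succ_top (by omega), ih]
    push_cast
    ring

lemma sum_Icc_two_eq {M : Type*} [AddCommMonoid M] (f : ℕ → M) (T : ℕ) :
    ∑ t ∈ Finset.Icc 2 (T + 1), f t = ∑ t ∈ Finset.Icc 1 T, f (t + 1) := by
  induction T with
  | zero => simp
  | succ n ih =>
    rw [Finset.sum_Icc_succ_top (a := 2) (b := n + 1) (by omega),
      Finset.sum_Icc_succ_top (a := 1) (b := n) (by omega), ih]

end Pathwise

/-! ### One stage of SPG in expectation. -/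

section Stage

variable {d : ℕ} {g h : Vec d → ℝ} {r : Vec d → EReal} {L μ γ Δ G : ℝ} {x₁ : Vec d}
  {p J : Vec d → Vec d} {Ξ Z : Type*} [MeasurableSpace Ξ] [MeasurableSpace Z]
  {νξ : Measure Ξ} {νς : Measure Z} {vg : Vec d → Ξ → Vec d} {vh : Vec d → Z → Vec d}

lemma spg_update_eq (hμ : 0 < μ) (hγ : 0 < γ) {c v y x : Vec d} {t : ℕ}
    (hx : IsMinOn (fun x => inner ℝ x v + quadReg μ x + γ / 2 * ‖x - c‖ ^ 2
        + 1 / (2 * (3 / (γ * (t + 1)))) * ‖x - y‖ ^ 2) univ x) :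
    x = proxStep μ γ (3 / (γ * (t + 1))) c y v := by
  refine eq_proxStep_of_isMinOn (k := 0) (by positivity) (fun x => ?_) hx
  have h1 : 1 / (2 * (3 / (γ * ((t : ℝ) + 1)))) = (3 / (γ * (t + 1)))⁻¹ / 2 := by
    rw [one_div, mul_inv]; ring
  rw [real_inner_comm, h1, quadReg]
  ring

set_option maxHeartbeats 1000000 in
/-- One stage with SPG as subroutine: measurability of the output and the descent of the expected
gap of the smoothed objective. `𝓕 t` is the information before the `t`-th sample is drawn. -/
lemma SmoothedDC.spg_stage (S : SmoothedDC g h r L μ γ x₁ Δ p J) (hγL : 3 * L ≤ γ)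
    [IsProbabilityMeasure νξ] [IsProbabilityMeasure νς]
    (hvg : UnbiasedGradient νξ vg g) (hvh : UnbiasedGradient νς vh h)
    (hvar : VarianceBound νξ νς vg vh G)
    {Ω : Type*} (𝓕 : ℕ → MeasurableSpace Ω) {mΩ : MeasurableSpace Ω} {P : Measure Ω}
    [IsProbabilityMeasure P] (hmono : Monotone 𝓕) (hle : ∀ t, 𝓕 t ≤ mΩ)
    {s : ℕ → Ω → Ξ × Z} (hs : ∀ t, Measurable[𝓕 (t + 1)] (s t))
    (hlaw : ∀ t, P.map (s t) = νξ.prod νς)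
    (hind : ∀ t, Indep (𝓕 t) (MeasurableSpace.comap (s t) inferInstance) P)
    {T : ℕ} (hT : 3 ≤ T) {c out : Ω → Vec d} (hc : Measurable[𝓕 1] c)
    (hci : Integrable (fun ω => envGap g h r μ x₁ Δ (c ω)) P)
    (hcall : ∀ ω, SPGCall vg (fun x ς => vh x ς + μ⁻¹ • p x) (quadReg μ) γ T (c ω)
      (fun t => s t ω) (out ω)) :
    Measurable[𝓕 (T + 1)] out ∧ Integrable (fun ω => envGap g h r μ x₁ Δ (out ω)) P ∧
      γ / 4 * ∫ ω, ‖c ω - stagePoint h μ γ p J (c ω)‖ ^ 2 ∂P ≤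
        ∫ ω, envGap g h r μ x₁ Δ (c ω) ∂P - ∫ ω, envGap g h r μ x₁ Δ (out ω) ∂P +
          24 * G ^ 2 / γ * (1 / T) := by
  have hL := S.L_pos
  have hγ := S.γ_pos
  have hμ := S.μ_pos
  choose y hy1 hmin hout using hcall
  have hstep : ∀ t ∈ Finset.Icc 1 T, ∀ ω, y ω (t + 1) = proxStep μ γ (3 / (γ * (t + 1))) (c ω)
      (y ω t) (vg (y ω t) (s t ω).1 - (vh (c ω) (s t ω).2 + μ⁻¹ • p (c ω))) :=
    fun t ht ω => spg_update_eq hμ hγ (hmin ω t ht)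
  have hym : ∀ t, 1 ≤ t → t ≤ T + 1 → Measurable[𝓕 t] fun ω => y ω t := by
    intro t ht
    induction t, ht using Nat.le_induction with
    | base => intro _; simpa only [hy1] using hc
    | succ t ht ih =>
      intro htT
      have hyt := (ih (by omega)).mono (hmono (Nat.le_succ t)) le_rfl
      have hct : Measurable[𝓕 (t + 1)] c := hc.mono (hmono (by omega)) le_rfl
      have hst := hs t
      have heq : (fun ω => y ω (t + 1)) = _ := funext (hstep t (by simp; omega))
      rw [heq]
      have e1 : Measurable[𝓕 (t + 1)] fun ω => vg (y ω t) (s t ω).1 :=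
        hvg.1.comp (hyt.prodMk (measurable_fst.comp hst))
      have e2 : Measurable[𝓕 (t + 1)] fun ω => vh (c ω) (s t ω).2 :=
        hvh.1.comp (hct.prodMk (measurable_snd.comp hst))
      have e3 : Measurable[𝓕 (t + 1)] fun ω => μ⁻¹ • p (c ω) :=
        (S.p_measurable.const_smul μ⁻¹).comp hct
      exact measurable_proxStep hct hyt (e1.sub (e2.add e3))
  have houtm : Measurable[𝓕 (T + 1)] out := by
    have heq : out = fun ω => (∑ t ∈ Finset.Icc 2 (T + 1), (t : ℝ))⁻¹ •
      ∑ t ∈ Finset.Icc 2 (T + 1), (t : ℝ) • y ω t := funext hout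
    rw [heq]
    refine Measurable.const_smul (c := (∑ t ∈ Finset.Icc 2 (T + 1), (t : ℝ))⁻¹)
      (Finset.measurable_fun_sum _ fun t ht => ?_)
    rw [Finset.mem_Icc] at ht
    exact ((hym t (by omega) ht.2).mono (hmono ht.2) le_rfl).const_smul (t : ℝ)
  set z := fun ω => stagePoint h μ γ p J (c ω) with hz
  set N := fun t ω => gradNoise g h vg vh (y ω t, c ω) (s t ω) with hN
  have hcm : Measurable c := hc.mono (hle 1) le_rfl
  have hzm : Measurable z := S.measurable_stagePoint.comp hcm
  have hyΩ : ∀ t ∈ Finset.Icc 1 T, Measurable fun ω => y ω t := fun t ht => by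
    rw [Finset.mem_Icc] at ht
    exact (hym t ht.1 (by omega)).mono (hle t) le_rfl
  have hsΩ : ∀ t, Measurable (s t) := fun t => (hs t).mono (hle _) le_rfl
  have hUm : ∀ t ∈ Finset.Icc 1 T, Measurable fun ω => (y ω t, c ω) := fun t ht =>
    (hyΩ t ht).prodMk hcm
  have hUind : ∀ t ∈ Finset.Icc 1 T, IndepFun (fun ω => (y ω t, c ω)) (s t) P := by
    intro t ht
    rw [Finset.mem_Icc] at ht
    have e1 : Measurable[𝓕 t] fun ω => (y ω t, c ω) :=
      (hym t ht.1 (by omega)).prodMk (hc.mono (hmono ht.1) le_rfl)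
    exact (IndepFun_iff_Indep _ _ _).2 (indep_of_indep_of_le_left (hind t) e1.comap_le)
  have hnoise := measurable_gradNoise S.g_smooth S.h_smooth hvg.1 hvh.1
  have hNm : ∀ t ∈ Finset.Icc 1 T, Measurable (N t) := fun t ht =>
    hnoise.comp ((hUm t ht).prodMk (hsΩ t))
  have hNl : ∀ t ∈ Finset.Icc 1 T, ∫⁻ ω, ‖N t ω‖ₑ ^ 2 ∂P ≤ ENNReal.ofReal (4 * G ^ 2) :=
    fun t ht => lintegral_enorm_sq_fresh_le (hUm t ht) (hsΩ t) (hUind t ht) (hlaw t) hnoise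
      (lintegral_gradNoise_le hvg hvh hvar)
  have hNi : ∀ t ∈ Finset.Icc 1 T, Integrable (fun ω => ‖N t ω‖ ^ 2) P := fun t ht =>
    integrable_sq_norm_of_lintegral (hNm t ht).aestronglyMeasurable
      (ne_top_of_le_ne_top ENNReal.ofReal_ne_top (hNl t ht))
  have hNb : ∀ t ∈ Finset.Icc 1 T, ∫ ω, ‖N t ω‖ ^ 2 ∂P ≤ 4 * G ^ 2 := fun t ht => by
    have := hNl t ht
    rw [lintegral_enorm_sq (hNi t ht)] at this
    exact (ENNReal.ofReal_le_ofReal_iff (by positivity)).1 this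
  have hzspec : ∀ ω, gradient g (z ω) + (μ⁻¹ + γ) • z ω =
      (gradient h (c ω) + μ⁻¹ • p (c ω)) + γ • c ω := fun ω => S.stagePoint_spec (c ω)
  have hv : ∀ t ω, vg (y ω t) (s t ω).1 - (vh (c ω) (s t ω).2 + μ⁻¹ • p (c ω)) =
      gradient g (y ω t) - (gradient h (c ω) + μ⁻¹ • p (c ω)) + N t ω := fun t ω => by
    simp only [hN, gradNoise]; abel
  have hZi : Integrable (fun ω => ‖c ω - z ω‖ ^ 2) P :=
    S.integrable_sq_norm_sub_stagePoint hcm hci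
  -- Each step enlarges the distance to `z` by at most `‖N t‖ / e`, because `L ≤ γ` keeps the
  -- expansion factor `η⁻¹ + L` below `e`. Square integrability passes from `c - z` to all iterates
  -- and makes the cross terms integrable.
  have hyi : ∀ t, 1 ≤ t → t ≤ T → Integrable (fun ω => ‖y ω t - z ω‖ ^ 2) P := by
    intro t ht
    induction t, ht using Nat.le_induction with
    | base => intro _; simpa only [hy1] using hZi
    | succ t ht ih =>
      intro htT
      have htm : t ∈ Finset.Icc 1 T := by simp; omega
      have hyt := ih (by omega)
      set e := (3 / (γ * ((t : ℝ) + 1)))⁻¹ + μ⁻¹ + γ with he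
      have he0 : 0 < e := by positivity
      refine ((hyt.const_mul 2).add ((hNi t htm).const_mul (2 / e ^ 2))).mono'
        (((hyΩ (t + 1) (by simp; omega)).sub hzm).norm.pow_const 2).aestronglyMeasurable
        (Filter.Eventually.of_forall fun ω => ?_)
      have h1 := congrArg norm (smul_proxStep_sub (η := 3 / (γ * ((t : ℝ) + 1))) (y := y ω t)
        (v := vg (y ω t) (s t ω).1 - (vh (c ω) (s t ω).2 + μ⁻¹ • p (c ω))) he0 (hzspec ω))
      rw [← hstep t htm ω, hv t ω] at h1
      have h2 : gradient g (y ω t) - (gradient h (c ω) + μ⁻¹ • p (c ω)) + N t ω +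
          (gradient h (c ω) + μ⁻¹ • p (c ω)) - gradient g (z ω) =
          (gradient g (y ω t) - gradient g (z ω)) + N t ω := by abel
      rw [h2, norm_smul, Real.norm_eq_abs, abs_of_pos he0] at h1
      have h3 := norm_sub_le ((3 / (γ * ((t : ℝ) + 1)))⁻¹ • (y ω t - z ω))
        ((gradient g (y ω t) - gradient g (z ω)) + N t ω)
      have h4 := norm_add_le (gradient g (y ω t) - gradient g (z ω)) (N t ω)
      have h5 := S.g_smooth.2 (y ω t) (z ω)
      rw [norm_smul, Real.norm_eq_abs, abs_of_pos (by positivity)] at h3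
      have h6 : ((3 / (γ * ((t : ℝ) + 1)))⁻¹ + L) * ‖y ω t - z ω‖ ≤ e * ‖y ω t - z ω‖ := by
        refine mul_le_mul_of_nonneg_right ?_ (norm_nonneg _)
        have : 0 < μ⁻¹ := inv_pos.2 hμ
        rw [he]
        linarith
      have h7 : e * ‖y ω (t + 1) - z ω‖ ≤ e * (‖y ω t - z ω‖ + ‖N t ω‖ / e) := by
        rw [mul_add, mul_div_cancel₀ _ he0.ne']
        linarith
      have h8 := le_of_mul_le_mul_left h7 he0
      have h9 := pow_le_pow_left₀ (norm_nonneg _) h8 2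
      rw [Real.norm_eq_abs, abs_of_nonneg (sq_nonneg _)]
      simp only [Pi.add_apply]
      have h10 : 2 / e ^ 2 * ‖N t ω‖ ^ 2 = 2 * (‖N t ω‖ / e) ^ 2 := by
        rw [div_pow]; ring
      rw [h10]
      nlinarith [sq_nonneg (‖y ω t - z ω‖ - ‖N t ω‖ / e)]
  have hcross : ∀ t ∈ Finset.Icc 1 T,
      Integrable (fun ω => (inner ℝ (N t ω) (y ω t - z ω) : ℝ)) P := fun t ht =>
    integrable_inner_of_sq (hNm t ht).aestronglyMeasurable
      ((hyΩ t ht).sub hzm).aestronglyMeasurable (hNi t ht)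
      (hyi t (Finset.mem_Icc.1 ht).1 (Finset.mem_Icc.1 ht).2)
  have hcross0 : ∀ t ∈ Finset.Icc 1 T, ∫ ω, (inner ℝ (N t ω) (y ω t - z ω) : ℝ) ∂P = 0 :=
    fun t ht => integral_inner_fresh_eq_zero (hUm t ht) (hsΩ t) (hUind t ht) (hlaw t) hnoise
      (gradNoise_integral hvg hvh) (W := fun a => a.1 - stagePoint h μ γ p J a.2)
      (measurable_fst.sub (S.measurable_stagePoint.comp measurable_snd)) (hcross t ht)
  set W : ℝ := T * (T + 3) / 2 with hW
  have hT' : (3 : ℝ) ≤ T := by exact_mod_cast hT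
  have hW0 : 0 < W := by positivity
  have hRt : ∀ t ∈ Finset.Icc 1 T, Integrable (fun ω => 3 / γ * ‖N t ω‖ ^ 2 -
      ((t : ℝ) + 1) * inner ℝ (N t ω) (y ω t - z ω)) P := fun t ht =>
    ((hNi t ht).const_mul _).sub ((hcross t ht).const_mul _)
  set R := fun ω => ∑ t ∈ Finset.Icc 1 T, (3 / γ * ‖N t ω‖ ^ 2 -
      ((t : ℝ) + 1) * inner ℝ (N t ω) (y ω t - z ω)) with hR
  have hRi : Integrable R P := integrable_finsetSum _ hRt
  have hRle : ∫ ω, R ω ∂P ≤ 12 * G ^ 2 / γ * T := by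
    rw [hR, integral_finsetSum _ hRt]
    refine (Finset.sum_le_card_nsmul _ _ (12 * G ^ 2 / γ) fun t ht => ?_).trans_eq ?_
    · rw [integral_sub ((hNi t ht).const_mul _) ((hcross t ht).const_mul _), integral_const_mul,
        integral_const_mul, hcross0 t ht, mul_zero, sub_zero]
      refine (mul_le_mul_of_nonneg_left (hNb t ht) (by positivity)).trans_eq ?_
      ring
    · rw [Nat.card_Icc, Nat.add_sub_cancel, nsmul_eq_mul, mul_comm]
  have hpath : ∀ ω, envGap g h r μ x₁ Δ (out ω) + γ / 4 * ‖c ω - z ω‖ ^ 2 ≤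
      envGap g h r μ x₁ Δ (c ω) + W⁻¹ * R ω := by
    intro ω
    set u := gradient h (c ω) + μ⁻¹ • p (c ω) with hu
    have h1 := spg_sum_le (u := u) (c := c ω) (z := z ω) (y := y ω) (N := fun t => N t ω)
      S.g_convex S.g_smooth hμ hL hγL (hy1 ω) (T := T)
      fun t ht => by rw [hstep t ht ω, hv t ω]
    have h2 : 0 < ∑ t ∈ Finset.Icc 2 (T + 1), (t : ℝ) := by rw [sum_Icc_two]; exact hW0
    have h3 := stageObj_weighted_average_le (u := u) (c := c ω) S.g_convex S.g_smooth hμ hγ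
      (fun t _ => Nat.cast_nonneg (α := ℝ) t) h2 (y ω) (stageObj g μ γ u (c ω) (z ω))
    rw [← hout ω, sum_Icc_two, ← hW,
      sum_Icc_two_eq (fun t => (t : ℝ) * (stageObj g μ γ u (c ω) (y ω t) -
        stageObj g μ γ u (c ω) (z ω)))] at h3
    push_cast at h3
    have h4 := S.envGap_descent (c ω) (out ω)
    have h5 : 0 ≤ γ / 6 * ((T : ℝ) + 2) ^ 2 * ‖y ω (T + 1) - z ω‖ ^ 2 := by positivity
    have h6 : W * (stageObj g μ γ u (c ω) (out ω) - stageObj g μ γ u (c ω) (z ω)) ≤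
        R ω + 2 * γ / 3 * ‖c ω - z ω‖ ^ 2 := by linarith
    -- The initial distance, divided by the total weight `W`, may cost half of the descent `γ/2`;
    -- this requires `W ≥ 8/3`, which `3 ≤ T` ensures.
    have h7 : 2 * γ / 3 * ‖c ω - z ω‖ ^ 2 ≤ W * (γ / 4 * ‖c ω - z ω‖ ^ 2) := by
      have e1 : 8 / 3 ≤ W := by rw [hW]; nlinarith
      have e2 : 0 ≤ γ / 4 * ‖c ω - z ω‖ ^ 2 := by positivity
      nlinarith
    have h8 : stageObj g μ γ u (c ω) (out ω) - stageObj g μ γ u (c ω) (z ω) ≤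
        W⁻¹ * R ω + γ / 4 * ‖c ω - z ω‖ ^ 2 := by
      rw [← mul_le_mul_iff_right₀ hW0, mul_add, mul_inv_cancel_left₀ hW0.ne']
      linarith
    simp only [hz] at h8 ⊢
    linarith
  have houtΩ : Measurable out := houtm.mono (hle _) le_rfl
  have houti : Integrable (fun ω => envGap g h r μ x₁ Δ (out ω)) P := by
    refine (hci.add (hRi.const_mul W⁻¹)).mono'
      (S.measurable_envGap.comp houtΩ).aestronglyMeasurable
      (Filter.Eventually.of_forall fun ω => ?_)
    rw [Real.norm_eq_abs, abs_of_nonneg (S.envGap_nonneg _)]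
    have h1 := hpath ω
    have h2 : 0 ≤ γ / 4 * ‖c ω - z ω‖ ^ 2 := by positivity
    simp only [Pi.add_apply]
    linarith
  refine ⟨houtm, houti, ?_⟩
  have h1 : ∫ ω, (envGap g h r μ x₁ Δ (out ω) + γ / 4 * ‖c ω - z ω‖ ^ 2) ∂P ≤
      ∫ ω, (envGap g h r μ x₁ Δ (c ω) + W⁻¹ * R ω) ∂P :=
    integral_mono (houti.add (hZi.const_mul _)) (hci.add (hRi.const_mul _)) hpath
  rw [integral_add houti (hZi.const_mul _), integral_add hci (hRi.const_mul _),
    integral_const_mul, integral_const_mul] at h1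
  have h2 : W⁻¹ * ∫ ω, R ω ∂P ≤ 24 * G ^ 2 / γ * (1 / T) := by
    refine (mul_le_mul_of_nonneg_left hRle (by positivity)).trans ?_
    have e1 : W⁻¹ * (12 * G ^ 2 / γ * T) = 24 * G ^ 2 / γ * (1 / (T + 3)) := by
      rw [hW]; field_simp; ring
    rw [e1]
    refine mul_le_mul_of_nonneg_left ?_ (by positivity)
    exact one_div_le_one_div_of_le (by positivity) (by linarith)
  linarith

end Stage

/-! ### SPG: the filtration of the samples and the whole run. -/

section SPG

variable {d : ℕ} {g h : Vec d → ℝ} {r : Vec d → EReal} {L γ Δ G : ℝ} {x₁ : Vec d}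
  {p J : Vec d → Vec d} {Ξ Z : Type*} [MeasurableSpace Ξ] [MeasurableSpace Z]
  {νξ : Measure Ξ} {νς : Measure Z} {vg : Vec d → Ξ → Vec d} {vh : Vec d → Z → Vec d}

/-- The information carried by the samples that precede sample `t` of stage `k`. -/
abbrev samplePast {Ω : Type*} (s : ℕ → ℕ → Ω → Ξ × Z) (k t : ℕ) : MeasurableSpace Ω :=
  ⨆ j ∈ {j : ℕ × ℕ | j.1 < k ∨ (j.1 = k ∧ j.2 < t)},
    MeasurableSpace.comap (s j.1 j.2) inferInstance

lemma samplePast_mono {Ω : Type*} (s : ℕ → ℕ → Ω → Ξ × Z) (k : ℕ) :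
    Monotone (samplePast s k) := fun _ _ htt =>
  biSup_mono fun _ hj => hj.imp id fun h => ⟨h.1, h.2.trans_le htt⟩

lemma samplePast_le_succ {Ω : Type*} (s : ℕ → ℕ → Ω → Ξ × Z) (k t t' : ℕ) :
    samplePast s k t ≤ samplePast s (k + 1) t' :=
  biSup_mono fun _ hj => Or.inl (by rcases hj with h | h <;> omega)

lemma measurable_samplePast {Ω : Type*} (s : ℕ → ℕ → Ω → Ξ × Z) (k t : ℕ) :
    Measurable[samplePast s k (t + 1)] (s k t) := by
  refine Measurable.of_comap_le ?_
  exact le_biSup (fun j : ℕ × ℕ => MeasurableSpace.comap (s j.1 j.2) inferInstance)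
    (show (k, t) ∈ {j : ℕ × ℕ | j.1 < k ∨ (j.1 = k ∧ j.2 < t + 1)} from
      Or.inr ⟨rfl, Nat.lt_succ_self t⟩)

lemma samplePast_le {Ω : Type*} {m : MeasurableSpace Ω} {s : ℕ → ℕ → Ω → Ξ × Z}
    (hs : ∀ k t, Measurable (s k t)) (k t : ℕ) : samplePast s k t ≤ m :=
  iSup₂_le fun j _ => (hs j.1 j.2).comap_le

lemma indep_samplePast {Ω : Type*} {mΩ : MeasurableSpace Ω} {P : Measure Ω}
    {s : ℕ → ℕ → Ω → Ξ × Z} (hs : ∀ k t, Measurable (s k t))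
    (hind : iIndepFun (fun (j : ℕ × ℕ) => s j.1 j.2) P) (k t : ℕ) :
    Indep (samplePast s k t) (MeasurableSpace.comap (s k t) inferInstance) P := by
  have h1 := indep_iSup_of_disjoint (fun j : ℕ × ℕ => (hs j.1 j.2).comap_le)
    ((iIndepFun_iff_iIndep _ _ _).1 hind)
    (S := {j : ℕ × ℕ | j.1 < k ∨ (j.1 = k ∧ j.2 < t)}) (T := {(k, t)})
    (by rw [Set.disjoint_singleton_right]; simp)
  simpa only [samplePast, iSup_singleton] using h1

/-- Each term is at most `κ⁻¹ * k ^ (α - 1)`, hence at most `κ⁻¹ * K ^ (α - 1)` because `1 ≤ α`, and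
there are `K` terms. -/
lemma sum_rpow_mul_one_div_le {α κ : ℝ} (hα : 1 ≤ α) (hκ : 0 < κ) {T : ℕ → ℕ}
    (hT : ∀ k : ℕ, 1 ≤ k → κ * k ≤ (T k : ℝ)) (K : ℕ) :
    ∑ k ∈ Finset.Icc 1 K, (k : ℝ) ^ α * (1 / (T k : ℝ)) ≤ (K : ℝ) ^ α * κ⁻¹ := by
  rcases K.eq_zero_or_pos with rfl | hK
  · simp only [Finset.Icc_eq_empty_of_lt zero_lt_one, Finset.sum_empty]
    positivity
  have hK0 : (0 : ℝ) < K := by exact_mod_cast hK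
  refine (Finset.sum_le_card_nsmul _ _ ((K : ℝ) ^ (α - 1) * κ⁻¹) fun k hk => ?_).trans_eq ?_
  · rw [Finset.mem_Icc] at hk
    have hk0 : (0 : ℝ) < k := by exact_mod_cast hk.1
    have h1 : 1 / (T k : ℝ) ≤ (κ * k)⁻¹ := by
      rw [one_div]
      exact inv_anti₀ (by positivity) (hT k hk.1)
    have h2 : (k : ℝ) ^ α * (κ * k)⁻¹ = (k : ℝ) ^ (α - 1) * κ⁻¹ := by
      rw [Real.rpow_sub_one hk0.ne', mul_inv]
      ring
    refine (mul_le_mul_of_nonneg_left h1 (by positivity)).trans ?_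
    rw [h2]
    refine mul_le_mul_of_nonneg_right ?_ (by positivity)
    exact Real.rpow_le_rpow hk0.le (by exact_mod_cast hk.2) (by linarith)
  · rw [Nat.card_Icc, Nat.add_sub_cancel, nsmul_eq_mul, Real.rpow_sub_one hK0.ne']
    field_simp

theorem SPGRun.nearlyCritical [IsProbabilityMeasure νξ] [IsProbabilityMeasure νς]
    {Ω : Type*} {mΩ : MeasurableSpace Ω} {P : Measure Ω} [IsProbabilityMeasure P]
    {α A B ε : ℝ} {a K : ℕ} {T : ℕ → ℕ}
    (S : SmoothedDC g h r L (ε ^ a) γ x₁ Δ p J) (hγL : 3 * L ≤ γ)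
    (hvg : UnbiasedGradient νξ vg g) (hvh : UnbiasedGradient νς vh h)
    (hvar : VarianceBound νξ νς vg vh G)
    (hε : ε ∈ Ioc (0 : ℝ) 1) (hα : 1 ≤ α) (hK : 1 / ε ^ (2 * (a + 1)) ≤ (K : ℝ)) (hA : 0 ≤ A)
    (hpx : ∀ x, ‖x - p x‖ ^ 2 ≤ A * ε ^ 2 * (envGap g h r (ε ^ a) x₁ Δ x + 1))
    (hT : ∀ k, 1 ≤ k → 3 * L * k / γ + 3 ≤ (T k : ℝ))
    {s : ℕ → ℕ → Ω → Ξ × Z} {x : ℕ → Ω → Vec d} {τ : Ω → ℕ}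
    (hrun : SPGRun P νξ νς vg vh r x₁ (ε ^ a) γ α T K p s x τ) (hB0 : 0 ≤ B)
    (hB : (Δ + 24 * G ^ 2 / γ * ∑' k, 1 / (T k : ℝ) ≤ B ∧ Summable fun k => 1 / (T k : ℝ)) ∨
      ∀ k ∈ Finset.Icc 1 K, ∫ ω, envObj g h r (ε ^ a) (x k ω) ∂P -
        envObj g h r (ε ^ a) x₁ + Δ ≤ B) :
    NearlyCritical P g h r p x τ
      (rateConst L γ α A B (24 * G ^ 2 / γ * (3 * L / γ)⁻¹) * ε) := by
  have hL := S.L_pos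
  have hγ := S.γ_pos
  obtain ⟨hx₁, hcall⟩ := hrun.run
  have hT3 : ∀ k, 1 ≤ k → 3 ≤ T k := fun k hk => by
    have h1 := hT k hk
    have h2 : 0 ≤ 3 * L * k / γ := by positivity
    exact_mod_cast (by linarith : (3 : ℝ) ≤ T k)
  have hstage : ∀ k ∈ Finset.Icc 1 K, Measurable[samplePast s k 1] (x k) →
      Integrable (fun ω => envGap g h r (ε ^ a) x₁ Δ (x k ω)) P → _ := fun k hk hx hi =>
    S.spg_stage hγL hvg hvh hvar (samplePast s k) (samplePast_mono s k)
      (samplePast_le hrun.sample_measurable k) (measurable_samplePast s k) (hrun.sample_law k)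
      (indep_samplePast hrun.sample_measurable hrun.sample_indep k)
      (hT3 k (Finset.mem_Icc.1 hk).1) hx hi (hcall k hk)
  have hxi : ∀ k, 1 ≤ k → k ≤ K + 1 → Measurable[samplePast s k 1] (x k) ∧
      Integrable (fun ω => envGap g h r (ε ^ a) x₁ Δ (x k ω)) P := by
    intro k hk
    induction k, hk using Nat.le_induction with
    | base =>
      intro _
      have : x 1 = fun _ => x₁ := funext hx₁
      rw [this]
      exact ⟨measurable_const, integrable_const _⟩
    | succ k hk ih =>
      intro hkK
      obtain ⟨h1, h2⟩ := ih (by omega)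
      obtain ⟨h3, h4, -⟩ := hstage k (by simp; omega) h1 h2
      exact ⟨h3.mono (samplePast_le_succ s k _ _) le_rfl, h4⟩
  have hxi' : ∀ k ∈ Finset.Icc 1 K, Measurable[samplePast s k 1] (x k) ∧
      Integrable (fun ω => envGap g h r (ε ^ a) x₁ Δ (x k ω)) P := fun k hk => by
    rw [Finset.mem_Icc] at hk
    exact hxi k hk.1 (by omega)
  have hdesc := fun k (hk : k ∈ Finset.Icc 1 K) =>
    (hstage k hk (hxi' k hk).1 (hxi' k hk).2).2.2
  have hbound : ∀ k ∈ Finset.Icc 1 K, ∫ ω, envGap g h r (ε ^ a) x₁ Δ (x k ω) ∂P ≤ B := by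
    rcases hB with ⟨hB, hsum⟩ | hB
    -- Dropping the squared distances, the descent adds at most one error term per stage. The term
    -- `j = 0` belongs to no stage and is harmless, being nonnegative.
    · have hpart : ∀ k, 1 ≤ k → k ≤ K → ∫ ω, envGap g h r (ε ^ a) x₁ Δ (x k ω) ∂P ≤
          Δ + 24 * G ^ 2 / γ * ∑ j ∈ Finset.range k, 1 / (T j : ℝ) := by
        intro k hk
        induction k, hk using Nat.le_induction with
        | base =>
          intro _
          simp only [hx₁, SmoothedDC.envGap_self, integral_const, probReal_univ, one_smul]
          have : 0 ≤ 24 * G ^ 2 / γ * ∑ j ∈ Finset.range 1, 1 / (T j : ℝ) := by positivity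
          linarith
        | succ k hk ih =>
          intro hkK
          have h1 := ih (by omega)
          have h2 := hdesc k (by simp; omega)
          have h3 : 0 ≤ γ / 4 * ∫ ω, ‖x k ω - stagePoint h (ε ^ a) γ p J (x k ω)‖ ^ 2 ∂P :=
            mul_nonneg (by positivity) (integral_nonneg fun ω => sq_nonneg _)
          rw [Finset.sum_range_succ, mul_add]
          linarith
      intro k hk
      rw [Finset.mem_Icc] at hk
      refine (hpart k hk.1 hk.2).trans (le_trans ?_ hB)
      have h1 := hsum.sum_le_tsum (Finset.range k) fun j _ => by positivity
      have h2 := mul_le_mul_of_nonneg_left h1 (by positivity : 0 ≤ 24 * G ^ 2 / γ)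
      linarith
    · intro k hk
      refine le_trans (le_of_eq ?_) (hB k hk)
      have hi : Integrable (fun ω => envObj g h r (ε ^ a) (x k ω)) P := by
        have h1 := ((hxi' k hk).2.sub (integrable_const Δ)).add
          (integrable_const (envObj g h r (ε ^ a) x₁))
        refine h1.congr (Filter.Eventually.of_forall fun ω => ?_)
        simp only [envGap, Pi.add_apply, Pi.sub_apply]
        ring
      simp only [envGap]
      have hi' : Integrable (fun ω => envObj g h r (ε ^ a) (x k ω) -
        envObj g h r (ε ^ a) x₁) P := hi.sub (integrable_const _)
      rw [integral_add hi' (integrable_const _), integral_sub hi (integrable_const _)]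
      simp
  set F : Ω → (ℕ × ℕ → Ξ × Z) := fun ω j => s j.1 j.2 ω with hF
  have hFm : Measurable F := measurable_pi_lambda _ fun j => hrun.sample_measurable _ _
  have hsF : ∀ k t, Measurable[MeasurableSpace.comap F inferInstance] (s k t) := fun k t =>
    (measurable_pi_apply (k, t)).comp (comap_measurable F)
  have hind : Indep (MeasurableSpace.comap τ inferInstance)
      (MeasurableSpace.comap F inferInstance) P := (IndepFun_iff_Indep _ _ _).1 hrun.index_indep
  refine S.nearlyCritical (θ := fun k => 24 * G ^ 2 / γ * (1 / T k)) hε (by linarith) hK hA hB0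
    (by positivity) hpx hrun.index_law hFm.comap_le hind
    -- The past of any stage lies in the σ-algebra of all samples, from which `τ` is independent.
    (fun k hk => (hxi' k hk).1.mono (samplePast_le hsF k 1) le_rfl)
    (fun k hk => (hxi' k hk).2) hbound hdesc ?_
  have h1 := sum_rpow_mul_one_div_le (κ := 3 * L / γ) hα (by positivity)
    (fun k hk => by
      have e1 := hT k hk
      have e2 : 3 * L / γ * k = 3 * L * k / γ := by ring
      linarith) (T := T) K
  have h2 := mul_le_mul_of_nonneg_left h1 (by positivity : 0 ≤ 24 * G ^ 2 / γ)
  rw [Finset.mul_sum] at h2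
  calc _ = ∑ k ∈ Finset.Icc 1 K, 24 * G ^ 2 / γ * ((k : ℝ) ^ α * (1 / (T k : ℝ))) :=
        Finset.sum_congr rfl fun k _ => by ring
    _ ≤ _ := h2
    _ = _ := by ring

end SPG

/-! ### Bounds uniform in the smoothing parameter. -/

section Uniform

variable {d : ℕ} {g h : Vec d → ℝ} {r : Vec d → EReal} {x₁ : Vec d}

/-- The constants in the gap and in the distance to the proximal point that do not depend on the
smoothing parameter. -/
lemma exists_uniform_bounds (hr : ProperLsc r) (hx₁ : r x₁ ≠ ⊤) {a : ℕ}
    (hreg : (RegLipschitz r ∧ a = 1) ∨ (LowerBounded r ∧ a = 2))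
    (hgap : InitialGap g h r x₁) :
    ∃ Δ A ε₀ : ℝ, 0 ≤ Δ ∧ 0 ≤ A ∧ 0 < ε₀ ∧ ε₀ ≤ 1 ∧ ∀ ε ∈ Ioc 0 ε₀, ∀ p : Vec d → Vec d,
      (∀ x, p x ∈ prox (ε ^ a) r x) →
      (∀ y, envObj g h r (ε ^ a) x₁ - envObj g h r (ε ^ a) y ≤ Δ) ∧
      ∀ x, ‖x - p x‖ ^ 2 ≤ A * ε ^ 2 * (envGap g h r (ε ^ a) x₁ Δ x + 1) := by
  obtain ⟨Δ, μ₀, hμ₀, hgap⟩ := hgap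
  have hΔ : 0 ≤ Δ := by simpa using hgap μ₀ ⟨hμ₀, le_rfl⟩ x₁
  -- With `ε ≤ 1` one has `ε ^ a ≤ ε` for `a ≠ 0`, so `ε ≤ μ₀ / 2` gives the separation `2 * μ ≤ μ₀`
  -- of the two envelopes.
  have hε₀ : 0 < min 1 (μ₀ / 2) := lt_min one_pos (by positivity)
  have hpow : ∀ ε ∈ Ioc 0 (min 1 (μ₀ / 2)), 0 < ε ^ a ∧ (a ≠ 0 → 2 * ε ^ a ≤ μ₀) := by
    intro ε hε
    have h1 := hε.2.trans (min_le_left _ _)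
    have h2 := hε.2.trans (min_le_right _ _)
    exact ⟨pow_pos hε.1 a, fun ha => by linarith [pow_le_of_le_one hε.1.le h1 ha]⟩
  rcases hreg with ⟨⟨ρ, hρ, G, hG⟩, rfl⟩ | ⟨hb, rfl⟩
  · refine ⟨Δ, 4 * G ^ 2, _, hΔ, by positivity, hε₀, min_le_left _ _, fun ε hε p hp => ?_⟩
    obtain ⟨h1, h2⟩ := hpow ε hε
    have hgap' := hgap (ε ^ 1) ⟨h1, by linarith [h2 one_ne_zero]⟩
    refine ⟨hgap', fun x => ?_⟩
    have h3 := norm_sub_prox_le_of_lipschitz hρ hG h1 (hp x)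
    have h4 : 0 ≤ envGap g h r (ε ^ 1) x₁ Δ x := by
      have := hgap' x
      simp only [envGap]
      linarith
    have h5 := pow_le_pow_left₀ (norm_nonneg _) h3 2
    have h6 : 0 ≤ 4 * (G : ℝ) ^ 2 * ε ^ 2 * envGap g h r (ε ^ 1) x₁ Δ x := by positivity
    rw [pow_one ε] at *
    nlinarith
  · set Q := (r x₁).toReal - (moreau μ₀ r x₁).toReal with hQ
    -- Here `μ = ε ^ 2` itself supplies the factor `ε ^ 2`; in the Lipschitz case it comes from
    -- squaring `2 * μ * G` with `μ = ε`.
    refine ⟨Δ, 4 * (1 + |Q|), _, hΔ, by positivity, hε₀, min_le_left _ _, fun ε hε p hp => ?_⟩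
    obtain ⟨h1, h2⟩ := hpow ε hε
    have hgap' := hgap (ε ^ 2) ⟨h1, by linarith [h2 two_ne_zero]⟩
    refine ⟨hgap', fun x => ?_⟩
    have h3 := sq_norm_sub_prox_le_of_gap hr hb hx₁ hμ₀ (hgap μ₀ ⟨hμ₀, le_rfl⟩) h1
      (h2 two_ne_zero) (hp x) ⟨_, hp x₁⟩
    have h4 : 0 ≤ envGap g h r (ε ^ 2) x₁ Δ x := by
      have := hgap' x
      simp only [envGap]
      linarith
    rw [← hQ] at h3
    change _ ≤ 4 * ε ^ 2 * (envGap g h r (ε ^ 2) x₁ Δ x + Q) at h3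
    have h5 : envGap g h r (ε ^ 2) x₁ Δ x + Q ≤
        (1 + |Q|) * (envGap g h r (ε ^ 2) x₁ Δ x + 1) := by
      nlinarith [le_abs_self Q, mul_nonneg (abs_nonneg Q) h4]
    refine h3.trans ((mul_le_mul_of_nonneg_left h5 (by positivity)).trans_eq ?_)
    ring

end Uniform

end SSDC

/-! ### The theorem: choice of the constants. -/

open SSDC
theorem mainTheorem2 {d : ℕ} (g h : Vec d → ℝ) (r : Vec d → EReal) (L : ℝ) (hL : 0 < L)
    (hg_conv : ConvexOn ℝ univ g) (hh_conv : ConvexOn ℝ univ h)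
    (hg : LSmooth L g) (hh : LSmooth L h) (hr : ProperLsc r)
    (x₁ : Vec d) (hx₁ : r x₁ ≠ ⊤) :
    -- SPG; `(a, b) = (1, 4)` for Lipschitz `r`, `(a, b) = (2, 6)` for `r` finite and bounded below
    (∀ a b : ℕ, (RegLipschitz r ∧ a = 1 ∧ b = 4) ∨ (RegFinite r ∧ a = 2 ∧ b = 6) →
      InitialGap g h r x₁ →
      ∀ (Ξ Z : Type*) [MeasurableSpace Ξ] [MeasurableSpace Z]
        (νξ : Measure Ξ) (νς : Measure Z) [IsProbabilityMeasure νξ] [IsProbabilityMeasure νς]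
        (vg : Vec d → Ξ → Vec d) (vh : Vec d → Z → Vec d) (G : ℝ),
      UnbiasedGradient νξ vg g → UnbiasedGradient νς vh h → VarianceBound νξ νς vg vh G →
      ∀ γ : ℝ, 3 * L ≤ γ → ∀ α : ℝ, 1 ≤ α →
      ∀ T : ℕ → ℕ, (∀ k, 1 ≤ k → 3 * L * k / γ + 3 ≤ (T k : ℝ)) →
      ∀ Δ : ℝ, ∃ C ε₀ : ℝ, 0 < C ∧ 0 < ε₀ ∧ ∀ ε ∈ Ioc 0 ε₀,
      ∀ K : ℕ, 1 / ε ^ b ≤ (K : ℝ) →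
      ∀ (Ω : Type*) [MeasurableSpace Ω] (P : Measure Ω) [IsProbabilityMeasure P]
        (p : Vec d → Vec d) (s : ℕ → ℕ → Ω → Ξ × Z) (x : ℕ → Ω → Vec d) (τ : Ω → ℕ),
      SPGRun P νξ νς vg vh r x₁ (ε ^ a) γ α T K p s x τ →
      ((Summable fun k => 1 / (T k : ℝ)) ∨
        ∀ k ∈ Finset.Icc 1 K, ∀ y,
          ∫ ω, envObj g h r (ε ^ a) (x k ω) ∂P - envObj g h r (ε ^ a) y ≤ Δ) →
      NearlyCritical P g h r p x τ (C * ε)) ∧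
    -- SVRG for a finite sum `g`
    (∀ (n : ℕ) (gi : Fin n → Vec d → ℝ), 0 < n → (∀ i, LSmooth L (gi i)) →
      (∀ x, g x = 1 / (n : ℝ) * ∑ i, gi i x) →
      ∀ a b : ℕ, (RegLipschitz r ∧ InitialGap g h r x₁ ∧ a = 1 ∧ b = 4) ∨
        (RegFinite r ∧ InitialGap g h r x₁ ∧ a = 2 ∧ b = 6) ∨
        (RegLevelBounded g h r ∧ a = 2 ∧ b = 6) →
      ∀ γ : ℝ, 0 < γ → ∀ α : ℝ, 1 ≤ α →
      ∃ C ε₀ : ℝ, 0 < C ∧ 0 < ε₀ ∧ ∀ ε ∈ Ioc 0 ε₀,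
      ∀ K : ℕ, 1 / ε ^ b ≤ (K : ℝ) →
      ∀ T : ℕ → ℕ, (∀ k, max 2 (200 * L / γ) ≤ (T k : ℝ)) →
      ∀ (Ω : Type*) [MeasurableSpace Ω] (P : Measure Ω) [IsProbabilityMeasure P]
        (p : Vec d → Vec d) (i : ℕ → ℕ → ℕ → Ω → Fin n) (x : ℕ → Ω → Vec d) (τ : Ω → ℕ),
      SVRGRun P gi g h r x₁ L (ε ^ a) γ α T K p i x τ →
      NearlyCritical P g h r p x τ (C * ε)) := by
  constructor
  · intro a b hab hgap Ξ Z _ _ νξ νς _ _ vg vh G hvg hvh hvar γ hγL α hα T hT Δ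
    have hγ : 0 < γ := by linarith
    -- Both exponents are instances of one formula, from `‖x - z‖ ^ 2` of order `ε ^ (2 * (a + 1))`.
    have hb : b = 2 * (a + 1) := by rcases hab with h | h <;> omega
    subst hb
    obtain ⟨Δ₁, A, ε₀, hΔ₁, hA, hε₀, hε₀1, hunif⟩ := exists_uniform_bounds (a := a) hr hx₁
      (hab.imp (fun h => ⟨h.1, h.2.1⟩) fun h => ⟨h.1.1, h.2.1⟩) hgap
    -- One constant serves both alternatives on the gaps, which are decided only after `C` is
    -- chosen. If the series diverges, its `tsum` is zero by convention.
    set B := Δ₁ + 24 * G ^ 2 / γ * (∑' k, 1 / (T k : ℝ)) + |Δ| with hB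
    have htsum : 0 ≤ 24 * G ^ 2 / γ * ∑' k, 1 / (T k : ℝ) :=
      mul_nonneg (by positivity) (tsum_nonneg fun k => by positivity)
    have hB0 : 0 ≤ B := by positivity
    refine ⟨rateConst L γ α A B (24 * G ^ 2 / γ * (3 * L / γ)⁻¹), ε₀,
      rateConst_pos hL hγ (by linarith) hA hB0 (by positivity), hε₀, fun ε hε K hK Ω _ P _ p s x τ hrun hcase => ?_⟩
    obtain ⟨hgap', hpx⟩ := hunif ε hε p hrun.prox_mem
    have hμ : 0 < ε ^ a := pow_pos hε.1 a
    have hμ' : 0 < (ε ^ a)⁻¹ := inv_pos.2 hμ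
    obtain ⟨J, hJ, hJspec⟩ := exists_resolvent (M := (ε ^ a)⁻¹ + γ) hg_conv hg hL (by linarith)
    have S : SmoothedDC g h r L (ε ^ a) γ x₁ Δ₁ p J := ⟨hL, hμ, hγ, hg_conv, hh_conv, hg, hh, hr,
      hrun.prox_measurable, hrun.prox_mem, hgap', hJ, hJspec⟩
    refine hrun.nearlyCritical (A := A) (B := B) (G := G) S hγL hvg hvh hvar
      ⟨hε.1, hε.2.trans hε₀1⟩ hα hK hA hpx hT hB0 ?_
    rcases hcase with hsum | hcase
    · exact Or.inl ⟨by rw [hB]; linarith [abs_nonneg Δ], hsum⟩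
    · refine Or.inr fun k hk => ?_
      have := hcase k hk x₁
      rw [hB]
      linarith [le_abs_self Δ]
  · intro n gi _ hgi _ a b hab γ hγ α hα
    have hb : b = 2 * (a + 1) := by rcases hab with h | h | h <;> omega
    subst hb
    have hgap : InitialGap g h r x₁ := by
      rcases hab with h | h | h
      · exact h.2.1
      · exact h.2.1
      · exact initialGap_of_regLevelBounded hr hg.1.continuous hh.1.continuous hx₁ h.1
    have ha : a ≠ 0 := by rcases hab with h | h | h <;> omega
    obtain ⟨Δ₁, A, ε₀, hΔ₁, hA, hε₀, hε₀1, hunif⟩ := exists_uniform_bounds (a := a) hr hx₁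
      (by
        rcases hab with h | h | h
        · exact Or.inl ⟨h.1, h.2.2.1⟩
        · exact Or.inr ⟨h.1.1, h.2.2.1⟩
        · exact Or.inr ⟨h.1.2.2, h.2.1⟩) hgap
    -- The two extra thresholds give `3 * L ≤ 1/μ` and `1058 * L ^ 2 ≤ γ/μ`, the conditions for
    -- contraction and for descent. The former also provides the resolvent, whatever the size of
    -- `γ`.
    refine ⟨rateConst L γ α A Δ₁ (Δ₁ / 2), min ε₀ (min (3 * L)⁻¹ (γ / (1058 * L ^ 2))),
      rateConst_pos hL hγ (by linarith) hA hΔ₁ (by positivity),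
      lt_min hε₀ (lt_min (by positivity) (by positivity)),
      fun ε hε K hK T hT Ω _ P _ p i x τ hrun => ?_⟩
    have hε1 : ε ≤ ε₀ := hε.2.trans (min_le_left _ _)
    obtain ⟨hgap', hpx⟩ := hunif ε ⟨hε.1, hε1⟩ p hrun.prox_mem
    have hμ : 0 < ε ^ a := pow_pos hε.1 a
    have hμε : ε ^ a ≤ ε := pow_le_of_le_one hε.1.le (hε1.trans hε₀1) ha
    have hsmall : 3 * L ≤ (ε ^ a)⁻¹ := by
      rw [le_inv_comm₀ (by positivity) hμ]
      exact hμε.trans (hε.2.trans ((min_le_right _ _).trans (min_le_left _ _)))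
    have hsmall' : 1058 * L ^ 2 ≤ γ * (ε ^ a)⁻¹ := by
      have h1 : ε ^ a ≤ γ / (1058 * L ^ 2) :=
        hμε.trans (hε.2.trans ((min_le_right _ _).trans (min_le_right _ _)))
      rw [le_div_iff₀ (by positivity)] at h1
      rw [← div_eq_mul_inv, le_div_iff₀ hμ]
      linarith
    obtain ⟨J, hJ, hJspec⟩ := exists_resolvent (M := (ε ^ a)⁻¹ + γ) hg_conv hg hL (by linarith)
    have S : SmoothedDC g h r L (ε ^ a) γ x₁ Δ₁ p J := ⟨hL, hμ, hγ, hg_conv, hh_conv, hg, hh, hr,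
      hrun.prox_measurable, hrun.prox_mem, hgap', hJ, hJspec⟩
    exact hrun.nearlyCritical (A := A) S hgi ⟨hε.1, hε1.trans hε₀1⟩ (by linarith) hK hA hpx
      (fun k => by
        have := (le_max_left _ _).trans (hT k)
        exact_mod_cast (by linarith : (1 : ℝ) ≤ T k)) hsmall hsmall'
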